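/- Let $F$ be a field of characteristic different from $2$. For $u,v\in F^\times$ put $F_u=F[x]/(x^2-u)$ and $F_{u,v}=F[x,y]/(x^2-u,\,y^2-v)$, with $\sqrt u,\sqrt v$ the classes of $x,y$. Let $N_{u,v}\colon F_{u,v}^\times\to F^\times$ be the norm, let $N_u\colon F_{u,v}^\times\to F_v^\times$ be the norm of $F_{u,v}=(F_v)_u$ over $F_v$, and let $\sigma_u,\sigma_v$ be the $F$-automorphisms of $F_{u,v}$ such that $\sigma_u$ negates $\sqrt u$ and fixes $\sqrt v$, and $\sigma_v$ negates $\sqrt v$ and fixes $\sqrt u$. For a unit $\omega$, write $(\sigma-1)\omega=\sigma(\omega)/\omega$. The image in $F^\times$ of the norm map $F_u^\times\to F^\times$ is also denoted by $N_u$. Write $(u,v)$ for the class in $\mathrm{Br}(F)$ of the quaternion algebra with $i^2=u$, $j^2=v$, $ij=-ji$. Let $\Gamma_F=\mathrm{Gal}(F_{\mathrm{sep}}/F)$, and for $u\in F^\times$ let $\chi_u\colon\Gamma_F\to\mathbb Z/2\mathbb Z$ be the character with $g(\sqrt u)=(-1)^{\chi_u(g)}\sqrt u$. The mod $2$ Massey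 product $\langle a_1,a_2,a_3,a_4\rangle$ of elements of $F^\times$ is *defined* if there are continuous inhomogeneous $1$-cochains $m_{ij}\colon\Gamma_F\to\mathbb Z/2\mathbb Z$, for $1\le i<j\le 5$ with $(i,j)\ne(1,5)$, such that $m_{i,i+1}$ is a cocycle representing the class of $\chi_{a_i}$ and $\partial m_{ij}=\sum_{i<l<j}m_{il}\cup m_{lj}$ whenever $j>i+1$. **Proposition.** Let $a,b,c,d\in F^\times$ be such that $(a,b)=(b,c)=(c,d)=0$ in $\mathrm{Br}(F)$, and let $H=N_aN_{ac}N_dN_{bd}\subset F^\times$. Consider pairs $(\epsilon,\nu)\in F_{a,c}^\times\times F_{b,d}^\times$ such that $N_{a,c}(\epsilon)=b$ and $N_{b,d}(\nu)=c$ in $F^\times/F^{\times 2}$. (a) For every such pair $(\epsilon,\nu)$ there exist $e\in F^\times$ and $\omega\in F_{b,c}^\times$ such that $$N_a(\epsilon)\,N_d(\nu)=e\,\omega^2,\qquad(\sigma_b-1)(\sigma_c-1)\omega=-1 \qquad\qquad(*)$$ in $F_{b,c}$, where $N_a(\epsilon)\in F_c^\times$ and $N_d(\nu)\in F_b^\times$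 are viewed in $F_{b,c}^\times$. (b) The set of all $e\in F^\times$ for which there are such a pair $(\epsilon,\nu)$ and an $\omega\in F_{b,c}^\times$ satisfying $(*)$ is a single coset of $H$ in $F^\times$. (c) For every such pair $(\epsilon,\nu)$ and all $e,\omega$ satisfying $(*)$, the Massey product $\langle a,b,c,d\rangle$ is defined if and only if $e\in H$. -/

import Mathlib

universe u

open scoped Pointwise Quaternion

noncomputable section

namespace FourfoldMassey

/-! ### Quaternion algebras and their Brauer classes -/

section Brauer

variable {F : Type u} [Field F]

theorem quaternion_scalar_identity (a b : F) (x : ℍ[F,a,b]) :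
    algebraMap F ℍ[F,a,b] (a * b) * x
      + algebraMap F ℍ[F,a,b] b * (⟨0, 1, 0, 0⟩ * x * ⟨0, 1, 0, 0⟩)
      + algebraMap F ℍ[F,a,b] a * (⟨0, 0, 1, 0⟩ * x * ⟨0, 0, 1, 0⟩)
      - ⟨0, 0, 0, 1⟩ * x * ⟨0, 0, 0, 1⟩
      = algebraMap F ℍ[F,a,b] (4 * a * b * x.re) := by
  rw [QuaternionAlgebra.algebraMap_eq, QuaternionAlgebra.algebraMap_eq,
    QuaternionAlgebra.algebraMap_eq, QuaternionAlgebra.algebraMap_eq]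
  ext <;> simp <;> ring

theorem four_mul_units_ne_zero (hF : ringChar F ≠ 2) (a b : Fˣ) : (4 * a * b : F) ≠ 0 := by
  have h2 : (2 : F) ≠ 0 := Ring.two_ne_zero hF
  have h4 : (4 : F) ≠ 0 := by
    have : (4 : F) = 2 * 2 := by norm_num
    rw [this]
    exact mul_ne_zero h2 h2
  exact mul_ne_zero (mul_ne_zero h4 a.ne_zero) b.ne_zero

theorem re_mem_of_mem (hF : ringChar F ≠ 2) (a b : Fˣ) (I : TwoSidedIdeal ℍ[F,(a : F),(b : F)])
    (x : ℍ[F,(a : F),(b : F)]) (hx : x ∈ I) :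
    algebraMap F ℍ[F,(a : F),(b : F)] x.re ∈ I := by
  have h := quaternion_scalar_identity (a : F) (b : F) x
  have hmem : algebraMap F ℍ[F,(a : F),(b : F)] (4 * a * b * x.re) ∈ I := by
    rw [← h]
    refine I.sub_mem (I.add_mem (I.add_mem ?_ ?_) ?_) ?_
    · exact I.mul_mem_left _ _ hx
    · exact I.mul_mem_left _ _ (I.mul_mem_right _ _ (I.mul_mem_left _ _ hx))
    · exact I.mul_mem_left _ _ (I.mul_mem_right _ _ (I.mul_mem_left _ _ hx))
    · exact I.mul_mem_right _ _ (I.mul_mem_left _ _ hx)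
  have h' := I.mul_mem_left (algebraMap F ℍ[F,(a : F),(b : F)] (4 * a * b : F)⁻¹) _ hmem
  rwa [← map_mul, inv_mul_cancel_left₀ (four_mul_units_ne_zero hF a b)] at h'

theorem quaternion_isSimpleRing (hF : ringChar F ≠ 2) (a b : Fˣ) :
    IsSimpleRing ℍ[F,(a : F),(b : F)] := by
  refine IsSimpleRing.of_eq_bot_or_eq_top fun I => ?_
  by_contra! hI
  obtain ⟨hbot, htop⟩ := hI
  have key : ∀ x ∈ I, x.re = 0 := by
    intro x hx
    by_contra hre
    apply htop
    rw [← TwoSidedIdeal.one_mem_iff]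
    have h := I.mul_mem_left (algebraMap F ℍ[F,(a : F),(b : F)] (x.re)⁻¹) _
      (re_mem_of_mem hF a b I x hx)
    rwa [← map_mul, inv_mul_cancel₀ hre, map_one] at h
  apply hbot
  rw [eq_bot_iff]
  intro x hx
  have h0 := key x hx
  have h1 := key _ (I.mul_mem_right x ⟨0, 1, 0, 0⟩ hx)
  have h2 := key _ (I.mul_mem_right x ⟨0, 0, 1, 0⟩ hx)
  have h3 := key _ (I.mul_mem_right x ⟨0, 0, 0, 1⟩ hx)
  simp at h1 h2 h3
  rw [TwoSidedIdeal.mem_bot]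
  ext <;> simp [h0, h1, h2, h3]

theorem quaternion_isCentral (hF : ringChar F ≠ 2) (a b : Fˣ) :
    Algebra.IsCentral F ℍ[F,(a : F),(b : F)] := by
  have h2 : (2 : F) ≠ 0 := Ring.two_ne_zero hF
  have ha := a.ne_zero
  refine ⟨fun x hx => ?_⟩
  rw [Subalgebra.mem_center_iff] at hx
  have hi := hx ⟨0, 1, 0, 0⟩
  have hj := hx ⟨0, 0, 1, 0⟩
  rw [QuaternionAlgebra.ext_iff] at hi hj
  simp at hi hj
  have aux : ∀ y : F, -y = y → y = 0 := by
    intro y hy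
    have : 2 * y = 0 := by linear_combination -hy
    exact (mul_eq_zero.mp this).resolve_left h2
  have aux' : ∀ y : F, y = -y → y = 0 := fun y hy => aux y hy.symm
  rw [Algebra.mem_bot]
  refine ⟨x.re, ?_⟩
  rw [QuaternionAlgebra.algebraMap_eq]
  ext
  · rfl
  · exact (aux _ hj.2).symm
  · exact (aux' _ hi.2).symm
  · exact ((mul_eq_zero.mp (aux' _ hi.1)).resolve_left ha).symm

/-- The quaternion algebra `(a, b)`, with basis `1, i, j, ij` and `i² = a`, `j² = b`, `ij = -ji`,
as a finite-dimensional central simple algebra. -/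
def quaternionCSA (hF : ringChar F ≠ 2) (a b : Fˣ) : CSA.{u, u} F :=
  { AlgCat.of F ℍ[F,(a : F),(b : F)] with
    isCentral := quaternion_isCentral hF a b
    isSimple := quaternion_isSimpleRing hF a b
    fin_dim := inferInstanceAs (Module.Finite F ℍ[F,(a : F),(b : F)]) }

/-- The field `F`, as a central simple algebra over itself. -/
def trivialCSA (F : Type u) [Field F] : CSA.{u, u} F :=
  { AlgCat.of F F with
    isCentral := inferInstanceAs (Algebra.IsCentral F F)
    isSimple := inferInstanceAs (IsSimpleRing F)
    fin_dim := inferInstanceAs (Module.Finite F F) }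

/-- The class `(a, b)` in `Br(F)`. -/
def symbol (hF : ringChar F ≠ 2) (a b : Fˣ) : BrauerGroup.{u, u} F :=
  Quotient.mk (Brauer.CSA_Setoid F) (quaternionCSA hF a b)

/-- The neutral element of `Br(F)`, written `0` in additive notation. -/
def brauerZero (F : Type u) [Field F] : BrauerGroup.{u, u} F :=
  Quotient.mk (Brauer.CSA_Setoid F) (trivialCSA F)

end Brauer

/-! ### The étale algebras `F_u` and `F_{u,v}` -/

section Etale

variable {F : Type u} [Field F]

/-- `F_u = F[x]/(x² - u)`, with `F`-basis `1, √u`. -/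
abbrev QuadExt (u : Fˣ) : Type u := QuadraticAlgebra F (u : F) 0

/-- `F_{u,v} = F[x, y]/(x² - u, y² - v)`, presented as `(F_v)_u = F_v[x]/(x² - u)`.
An element is `z = z.re + z.im √u` with `z.re, z.im ∈ F_v`. Thus `Algebra.norm (QuadExt v)` is the
norm `N_u : F_{u,v} → F_v`, and `Algebra.norm F` is the norm `N_{u,v} : F_{u,v} → F`. -/
abbrev BiquadExt (u v : Fˣ) : Type u :=
  QuadraticAlgebra (QuadExt v) (algebraMap F (QuadExt v) (u : F)) 0

/-- The inclusion `F_u → F_{u,v}`, sending `√u` to `√u`. -/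
def inclLeft (u v : Fˣ) : QuadExt u →ₐ[F] BiquadExt u v where
  toFun z := ⟨algebraMap F (QuadExt v) z.re, algebraMap F (QuadExt v) z.im⟩
  map_one' := by ext <;> rfl
  map_mul' x y := by ext <;> simp
  map_zero' := by ext <;> simp
  map_add' x y := by ext <;> simp
  commutes' r := by ext <;> rfl

/-- The inclusion `F_v → F_{u,v}`, sending `√v` to `√v`. -/
def inclRight (u v : Fˣ) : QuadExt v →ₐ[F] BiquadExt u v :=
  IsScalarTower.toAlgHom F (QuadExt v) (BiquadExt u v)

/-- The automorphism `σ_u` of `F_{u,v}`: it sends `√u` to `-√u` and fixes `√v`. -/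
def sigmaLeft (u v : Fˣ) : BiquadExt u v ≃ₐ[F] BiquadExt u v where
  toFun z := ⟨z.re, -z.im⟩
  invFun z := ⟨z.re, -z.im⟩
  left_inv z := by simp
  right_inv z := by simp
  map_mul' x y := by ext <;> simp <;> ring
  map_add' x y := by ext <;> simp <;> ring
  commutes' r := by ext <;> first | rfl | exact neg_zero

/-- The automorphism `σ_v` of `F_{u,v}`: it sends `√v` to `-√v` and fixes `√u`. -/
def sigmaRight (u v : Fˣ) : BiquadExt u v ≃ₐ[F] BiquadExt u v where
  toFun z := ⟨⟨z.re.re, -z.re.im⟩, ⟨z.im.re, -z.im.im⟩⟩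
  invFun z := ⟨⟨z.re.re, -z.re.im⟩, ⟨z.im.re, -z.im.im⟩⟩
  left_inv z := by simp
  right_inv z := by simp
  map_mul' x y := by ext <;> simp <;> ring
  map_add' x y := by ext <;> simp <;> ring
  commutes' r := by ext <;> first | rfl | exact neg_zero

/-- `(σ - 1)ω = σ(ω)/ω`, in the additive notation for the action on units. -/
def subOne {A : Type u} [CommRing A] [Algebra F A] (σ : A ≃ₐ[F] A) (ω : Aˣ) : Aˣ :=
  Units.map (σ : A →* A) ω / ω

/-- The group `N_u` of nonzero norms from `F_u`. -/
def normGroup (u : Fˣ) : Subgroup Fˣ :=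
  (Units.map (Algebra.norm F : QuadExt u →* F)).range

/-- `x = y` in `Fˣ/Fˣ²`. -/
def EqModSquares (x y : Fˣ) : Prop := ∃ z : Fˣ, x = y * z ^ 2

/-- The condition `N_{u,v}(ε) = w` in `Fˣ/Fˣ²`, for `ε ∈ F_{u,v}ˣ`. -/
def NormEqModSquares {u v : Fˣ} (ε : (BiquadExt u v)ˣ) (w : Fˣ) : Prop :=
  EqModSquares (Units.map (Algebra.norm F : BiquadExt u v →* F) ε) w

end Etale

/-! ### Mod 2 cochains and Massey products -/

section Massey

variable (Γ : Type u) [Group Γ] [TopologicalSpace Γ]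

/-- Continuous inhomogeneous `n`-cochains of `Γ` with coefficients in `ℤ/2`. -/
abbrev Cochain (n : ℕ) : Type u := C(Fin n → Γ, ZMod 2)

variable {Γ}

/-- The differential of inhomogeneous cochains (trivial action on `ℤ/2`). -/
def diff [IsTopologicalGroup Γ] (n : ℕ) : Cochain Γ n →+ Cochain Γ (n + 1) where
  toFun f :=
    { toFun := fun g => f (fun i => g i.succ) +
        ∑ j : Fin (n + 1), (-1) ^ ((j : ℕ) + 1) * f (Fin.contractNth j (· * ·) g)
      continuous_toFun := by
        have h1 : Continuous fun g : Fin (n + 1) → Γ => f (fun i => g i.succ) :=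
          f.continuous.comp (by fun_prop)
        have h2 : ∀ j : Fin (n + 1), Continuous fun g : Fin (n + 1) → Γ =>
            (-1 : ZMod 2) ^ ((j : ℕ) + 1) * f (Fin.contractNth j (· * ·) g) := by
          intro j
          refine (continuous_of_discreteTopology
            (f := fun z : ZMod 2 => (-1 : ZMod 2) ^ ((j : ℕ) + 1) * z)).comp
              (f.continuous.comp (continuous_pi fun i => ?_))
          unfold Fin.contractNth
          split_ifs <;> fun_prop
        exact h1.add (continuous_finsetSum _ fun j _ => h2 j) }
  map_zero' := by ext; simp
  map_add' f h := by
    ext g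
    simp [mul_add, Finset.sum_add_distrib]
    ring

/-- The cup product of inhomogeneous cochains. -/
def cup {m n : ℕ} (f : Cochain Γ m) (h : Cochain Γ n) : Cochain Γ (m + n) where
  toFun g := f (fun i => g (Fin.castAdd n i)) * h (fun i => g (Fin.natAdd m i))
  continuous_toFun := by fun_prop

/-- `M` is a defining system for the Massey product of the classes of the 1-cocycles `χ 0, …`.
Indices start from `0`, and only the entries `M i j` with `i < j`, `(i, j) ≠ (0, n)` are used. -/
structure IsDefiningSystem [IsTopologicalGroup Γ] {n : ℕ} (χ : Fin n → Cochain Γ 1)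
    (M : Fin (n + 1) → Fin (n + 1) → Cochain Γ 1) : Prop where
  cocycle : ∀ i : Fin n, diff 1 (M i.castSucc i.succ) = 0
  represents : ∀ i : Fin n, M i.castSucc i.succ - χ i ∈ (diff (Γ := Γ) 0).range
  diff_eq : ∀ i j : Fin (n + 1), (i : ℕ) + 1 < j → ¬(i = 0 ∧ j = Fin.last n) →
    diff 1 (M i j) = ∑ l ∈ Finset.Ioo i j, cup (M i l) (M l j)

/-- The Massey product `⟨χ 0, …, χ (n - 1)⟩` is defined, i.e. it has a defining system. -/
def MasseyDefined [IsTopologicalGroup Γ] {n : ℕ} (χ : Fin n → Cochain Γ 1) : Prop :=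
  ∃ M : Fin (n + 1) → Fin (n + 1) → Cochain Γ 1, IsDefiningSystem χ M

end Massey

/-! ### Kummer characters -/

section Kummer

variable {F : Type u} [Field F]

/-- `Γ_F = Gal(F_sep/F)`, with the Krull topology. -/
abbrev AbsGal (F : Type u) [Field F] : Type u := Gal(SeparableClosure F/F)

open Classical in
/-- The value at `g` of the quadratic character attached to `a`:
it is `0` if `g` fixes the square roots of `a` and `1` otherwise. -/
def kummerFun (a : Fˣ) (g : AbsGal F) : ZMod 2 :=
  if ∀ s : SeparableClosure F, s ^ 2 = algebraMap F (SeparableClosure F) a → g s = s then 0 else 1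

/-- The usual description: `g(s) = (-1)^{χ_a(g)} s` whenever `s² = a`. -/
theorem kummerFun_spec (a : Fˣ) (g : AbsGal F) (s : SeparableClosure F)
    (hs : s ^ 2 = algebraMap F (SeparableClosure F) a) :
    g s = (-1) ^ (kummerFun a g).val * s := by
  classical
  unfold kummerFun
  split_ifs with h
  · simp [h s hs]
  · push Not at h
    obtain ⟨t, ht, hne⟩ := h
    have h1 : (g t) ^ 2 = t ^ 2 := by rw [← map_pow, ht, AlgEquiv.commutes]
    have h2 : g t = -t := (sq_eq_sq_iff_eq_or_eq_neg.mp h1).resolve_left hne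
    have h3 : g s = -s := by
      rcases sq_eq_sq_iff_eq_or_eq_neg.mp (hs.trans ht.symm) with rfl | rfl
      · exact h2
      · rw [map_neg, h2]
    rw [h3, ZMod.val_one]
    ring

theorem continuous_kummerFun (a : Fˣ) : Continuous (kummerFun a : AbsGal F → ZMod 2) := by
  classical
  have hclopen : IsClopen {g : AbsGal F |
      ∀ s : SeparableClosure F, s ^ 2 = algebraMap F (SeparableClosure F) a → g s = s} := by
    by_cases hex : ∃ t : SeparableClosure F, t ^ 2 = algebraMap F (SeparableClosure F) a
    · obtain ⟨t, ht⟩ := hex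
      have heq : {g : AbsGal F |
          ∀ s : SeparableClosure F, s ^ 2 = algebraMap F (SeparableClosure F) a → g s = s}
          = (MulAction.stabilizer (AbsGal F) t : Set (AbsGal F)) := by
        ext g
        constructor
        · intro h
          exact h t ht
        · intro h s hs
          have h' : g t = t := h
          rcases sq_eq_sq_iff_eq_or_eq_neg.mp (hs.trans ht.symm) with rfl | rfl
          · exact h'
          · rw [map_neg, h']
      rw [heq]
      have ho := stabilizer_isOpen_of_isIntegral (K := F) t
      exact ⟨Subgroup.isClosed_of_isOpen _ ho, ho⟩
    · have heq : {g : AbsGal F |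
          ∀ s : SeparableClosure F, s ^ 2 = algebraMap F (SeparableClosure F) a → g s = s}
          = Set.univ := by
        ext g
        simp only [Set.mem_ofPred_eq, Set.mem_univ, iff_true]
        exact fun s hs => (hex ⟨s, hs⟩).elim
      rw [heq]
      exact isClopen_univ
  unfold kummerFun
  refine Continuous.if (fun g hg => ?_) continuous_const continuous_const
  rw [hclopen.frontier_eq] at hg
  exact hg.elim

/-- The character `χ_a : Γ_F → ℤ/2` attached to `a ∈ Fˣ`, as a continuous 1-cochain. -/
def kummerChar (a : Fˣ) : Cochain (AbsGal F) 1 where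
  toFun g := kummerFun a (g 0)
  continuous_toFun := (continuous_kummerFun a).comp (continuous_apply 0)

end Kummer

/-! ### The scalar `e` attached to a fourfold Massey product -/

section Scalar

variable {F : Type u} [Field F]

/-- The equations `N_a(ε) N_d(ν) = e ω²` and `(σ_b - 1)(σ_c - 1)ω = -1` in `F_{b,c}`.
Here `F_{b,d}` is written `BiquadExt d b`, so that `N_d(ν) ∈ F_b`. -/
def ScalarEquations {a b c d : Fˣ} (ε : (BiquadExt a c)ˣ) (ν : (BiquadExt d b)ˣ)
    (e : Fˣ) (ω : (BiquadExt b c)ˣ) : Prop :=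
  inclRight b c (Algebra.norm (QuadExt c) (ε : BiquadExt a c)) *
      inclLeft b c (Algebra.norm (QuadExt b) (ν : BiquadExt d b)) =
    algebraMap F (BiquadExt b c) e * (ω : BiquadExt b c) ^ 2 ∧
  subOne (sigmaLeft b c) (subOne (sigmaRight b c) ω) = -1

end Scalar

end FourfoldMassey

end

/-!
The proof replaces Brauer classes and torsors by explicit square roots in the separable closure.
Elements of `F_v` and `F_{u,v}` are identified with the `Γ_F`-equivariant functions `ℤ/2 → F_sep` and
`(ℤ/2)² → F_sep` given by their conjugates; this makes sense also when `u`, `v` or `uv` is a square,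
so that the degenerate cases need no separate treatment.

An element `γ ∈ F_c` whose norm is `b` up to squares *presents* a cochain `φ` with
`∂φ = χ_b ∪ χ_c`: the group `Γ_F` permutes the square roots of the two conjugates of `γ` up to
signs, and these signs are `φ` and `φ + χ_b` (`exists_isLift_presents`). Multiplying `γ` by `y ∈ Fˣ`
adds `χ_y` to `φ`, and by Kummer theory every cochain with the same coboundary is obtained in this
way. The heart of the matter is that `⟨a, b, c⟩` vanishes for a defining system with second entry `φ`
if and only if `γ` is a norm from `F_{a,c}` (`exists_norm_eq_of_tripleVanishes`,
`tripleVanishes_of_norm_eq`). Indeed, such a defining system is a cocycle of signs on `(ℤ/2)²`, and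
Hilbert 90 in the form of `exists_monomial_basis` realises these signs by elements of `F_sep`, whose
squares are, up to a factor from `F_c`, the conjugates of an element of `F_{a,c}` with norm `γ`.
Conversely, the signs relating the square roots of the conjugates of such an element are a
defining system.

The Massey product `⟨a, b, c, d⟩` is therefore defined if and only if some `φ` is presented by a norm
from `F_{a,c}`, while `g ↦ φ (g⁻¹)`, which corresponds to the reversed sequence `d, c, b`, is presented
by a norm from `F_{b,d}`. Given `ε` and `ν`, their norms `γ ∈ F_c` and `β ∈ F_b` present
cochains `φ` and `φ'`, and the equations for `e` and `ω` say that `φ - φ' ∘ (·)⁻¹` is `χ_e` up to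
multiples of `χ_b` and `χ_c` (`exists_eq_of_scalarEquations`, `exists_scalarEquations`). These
multiples are harmless, because `b` is a norm from `F_a` and `c` is a norm from `F_d`. The scalars
`y` for which `yγ` remains a norm from `F_{a,c}` form the group `N_a N_{ac}` (`mem_sup_of_norm_eq`),
and symmetrically one obtains `N_d N_{bd}` for `β`, so everything is determined by the class of `e`
modulo the product `H` of these groups.
-/

noncomputable section

namespace FourfoldMassey

variable {F : Type u} [Field F]

/-! ### Signs, square roots and étale algebras as equivariant functions -/

/-- The sign `(-1)^x` attached to `x ∈ ℤ/2`. -/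
def sgn (R : Type*) [Ring R] (x : ZMod 2) : R := (-1) ^ x.val

theorem zmod_two_cases (x : ZMod 2) : x = 0 ∨ x = 1 := by
  fin_cases x
  · exact Or.inl rfl
  · exact Or.inr rfl

section Sign

variable {R : Type*} [Ring R]

@[simp] theorem sgn_zero : sgn R 0 = 1 := by simp [sgn]

@[simp] theorem sgn_one : sgn R 1 = -1 := by simp [sgn, ZMod.val_one]

theorem sgn_add (x y : ZMod 2) : sgn R (x + y) = sgn R x * sgn R y := by
  rcases zmod_two_cases x with rfl | rfl <;> rcases zmod_two_cases y with rfl | rfl <;>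
    simp [CharTwo.add_self_eq_zero]

theorem sgn_mul_self (x : ZMod 2) : sgn R x * sgn R x = 1 := by
  rw [← sgn_add, CharTwo.add_self_eq_zero, sgn_zero]

theorem sgn_sq (x : ZMod 2) : sgn R x ^ 2 = 1 := by rw [sq, sgn_mul_self]

theorem map_sgn {S G : Type*} [Ring S] [FunLike G R S] [RingHomClass G R S] (f : G) (x : ZMod 2) :
    f (sgn R x) = sgn S x := by
  simp [sgn]

end Sign

theorem sgn_ne_zero {K : Type*} [Field K] (x : ZMod 2) : sgn K x ≠ 0 := by
  rcases zmod_two_cases x with rfl | rfl <;> simp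

theorem sgn_injective {K : Type*} [Field K] (hK : (2 : K) ≠ 0) :
    Function.Injective (sgn K) := by
  have h : (1 : K) ≠ -1 := fun h => hK (by linear_combination h)
  intro x y hxy
  rcases zmod_two_cases x with rfl | rfl <;> rcases zmod_two_cases y with rfl | rfl
  · rfl
  · exact (h (by simpa using hxy)).elim
  · exact (h (by simpa using hxy.symm)).elim
  · rfl

theorem exists_sgn_of_sq_eq {K : Type*} [Field K] {s t : K} (h : s ^ 2 = t ^ 2) :
    ∃ x : ZMod 2, s = sgn K x * t := by
  rcases sq_eq_sq_iff_eq_or_eq_neg.mp h with h | h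
  · exact ⟨0, by simp [h]⟩
  · exact ⟨1, by simp [h]⟩

theorem sepClosure_two_ne_zero (hF : ringChar F ≠ 2) : (2 : SeparableClosure F) ≠ 0 := by
  have h2 : (2 : F) ≠ 0 := Ring.two_ne_zero hF
  have := (map_ne_zero (algebraMap F (SeparableClosure F))).mpr h2
  rwa [map_ofNat] at this

theorem exists_sq_eq (hF : ringChar F ≠ 2) (x : SeparableClosure F) :
    ∃ y : SeparableClosure F, y ^ 2 = x := by
  have : NeZero (2 : SeparableClosure F) := ⟨sepClosure_two_ne_zero hF⟩
  obtain ⟨z, hz⟩ := IsSepClosed.exists_eq_mul_self x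
  exact ⟨z, by rw [sq, hz]⟩

/-- A chosen square root of `u` in the separable closure. -/
def root (hF : ringChar F ≠ 2) (u : Fˣ) : SeparableClosure F :=
  (exists_sq_eq hF (algebraMap F (SeparableClosure F) u)).choose

theorem root_sq (hF : ringChar F ≠ 2) (u : Fˣ) :
    root hF u ^ 2 = algebraMap F (SeparableClosure F) u :=
  (exists_sq_eq hF (algebraMap F (SeparableClosure F) u)).choose_spec

theorem algebraMap_unit_ne_zero (u : Fˣ) : algebraMap F (SeparableClosure F) (u : F) ≠ 0 :=
  (map_ne_zero _).mpr u.ne_zero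

theorem root_ne_zero (hF : ringChar F ≠ 2) (u : Fˣ) : root hF u ≠ 0 := by
  intro h
  have := root_sq hF u
  rw [h] at this
  exact algebraMap_unit_ne_zero u (by rw [← this]; simp)

theorem map_root (hF : ringChar F ≠ 2) (u : Fˣ) (g : AbsGal F) :
    g (root hF u) = sgn _ (kummerFun u g) * root hF u :=
  kummerFun_spec u g _ (root_sq hF u)

/-- `kummerFun u` is determined by its effect on any nonzero square root of `u`. -/
theorem eq_kummerFun (hF : ringChar F ≠ 2) {u : Fˣ} {s : SeparableClosure F} (hs : s ≠ 0)
    (hsu : s ^ 2 = algebraMap F (SeparableClosure F) u) {g : AbsGal F} {x : ZMod 2}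
    (h : g s = sgn _ x * s) : x = kummerFun u g :=
  sgn_injective (sepClosure_two_ne_zero hF)
    (mul_right_cancel₀ hs (h.symm.trans (kummerFun_spec u g s hsu)))

theorem kummerFun_mul_apply (hF : ringChar F ≠ 2) (u : Fˣ) (g h : AbsGal F) :
    kummerFun u (g * h) = kummerFun u g + kummerFun u h := by
  symm
  refine eq_kummerFun hF (root_ne_zero hF u) (root_sq hF u) ?_
  rw [AlgEquiv.mul_apply, map_root, map_mul, map_sgn, map_root, sgn_add]
  ring

theorem kummerFun_unit_mul (hF : ringChar F ≠ 2) (u v : Fˣ) (g : AbsGal F) :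
    kummerFun (u * v) g = kummerFun u g + kummerFun v g := by
  symm
  refine eq_kummerFun hF (mul_ne_zero (root_ne_zero hF u) (root_ne_zero hF v))
    (by rw [mul_pow, root_sq, root_sq, Units.val_mul, map_mul]) ?_
  rw [map_mul, map_root, map_root, sgn_add]
  ring

theorem kummerFun_inv_apply (hF : ringChar F ≠ 2) (u : Fˣ) (g : AbsGal F) :
    kummerFun u g⁻¹ = kummerFun u g := by
  have h := kummerFun_mul_apply hF u g g⁻¹
  have h1 := kummerFun_mul_apply hF u 1 1
  rw [mul_inv_cancel] at h
  rw [mul_one] at h1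
  have h1' : kummerFun u (1 : AbsGal F) = 0 := by simpa using h1
  rw [h1'] at h
  exact (CharTwo.add_eq_zero.mp h.symm).symm

theorem mem_range_of_fixed {x : SeparableClosure F} (h : ∀ g : AbsGal F, g x = x) :
    ∃ y : F, algebraMap F (SeparableClosure F) y = x := by
  have := (InfiniteGalois.mem_range_algebraMap_iff_fixed (k := F) x).mpr h
  simpa using this

/-- The function `z ↦ z.re + z.im (-1)^j √v` on `F_v`, with `√v` the chosen square root. -/
def eval (hF : ringChar F ≠ 2) (v : Fˣ) (j : ZMod 2) : QuadExt v →ₐ[F] SeparableClosure F :=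
  QuadraticAlgebra.lift ⟨sgn _ j * root hF v, by
    have h := root_sq hF v
    have h' := sgn_sq (R := SeparableClosure F) j
    rw [Algebra.smul_def, zero_smul]
    linear_combination (sgn _ j) ^ 2 * h + algebraMap F _ (v : F) * h'⟩

theorem eval_apply (hF : ringChar F ≠ 2) (v : Fˣ) (j : ZMod 2) (z : QuadExt v) :
    eval hF v j z = algebraMap F _ z.re + algebraMap F _ z.im * (sgn _ j * root hF v) := by
  simp [eval, QuadraticAlgebra.lift, Algebra.smul_def]

theorem map_eval (hF : ringChar F ≠ 2) (v : Fˣ) (j : ZMod 2) (z : QuadExt v) (g : AbsGal F) :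
    g (eval hF v j z) = eval hF v (j + kummerFun v g) z := by
  rw [eval_apply, eval_apply, map_add, map_mul, map_mul, map_sgn, map_root, sgn_add,
    AlgEquiv.commutes, AlgEquiv.commutes]
  ring

theorem eval_ext (hF : ringChar F ≠ 2) {v : Fˣ} {y z : QuadExt v}
    (h : ∀ j, eval hF v j y = eval hF v j z) : y = z := by
  have h2 := sepClosure_two_ne_zero hF
  have hr := root_ne_zero hF v
  have h0 := h 0
  have h1 := h 1
  simp only [eval_apply, sgn_zero, sgn_one] at h0 h1
  have hre : algebraMap F (SeparableClosure F) y.re = algebraMap F _ z.re :=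
    mul_left_cancel₀ h2 (by linear_combination h0 + h1)
  have him : algebraMap F (SeparableClosure F) y.im = algebraMap F _ z.im :=
    mul_left_cancel₀ (mul_ne_zero h2 hr) (by linear_combination h0 - h1)
  exact QuadraticAlgebra.ext ((algebraMap F _).injective hre) ((algebraMap F _).injective him)

/-- Galois descent for `F_v`: equivariant functions `ℤ/2 → F_sep` come from elements of `F_v`. -/
theorem exists_eval_eq (hF : ringChar F ≠ 2) (v : Fˣ) (w : ZMod 2 → SeparableClosure F)
    (hw : ∀ (g : AbsGal F) j, g (w j) = w (j + kummerFun v g)) :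
    ∃ z : QuadExt v, ∀ j, eval hF v j z = w j := by
  have h2 := sepClosure_two_ne_zero hF
  have hr := root_ne_zero hF v
  have e1 : (1 : ZMod 2) + 1 = 0 := rfl
  obtain ⟨x, hx⟩ : ∃ x : F, algebraMap F _ x = (w 0 + w 1) / 2 := by
    refine mem_range_of_fixed fun g => ?_
    rw [map_div₀, map_add, hw, hw, map_ofNat]
    rcases zmod_two_cases (kummerFun v g) with h | h <;> simp [h, e1, add_comm]
  obtain ⟨y, hy⟩ : ∃ y : F, algebraMap F _ y = (w 0 - w 1) / (2 * root hF v) := by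
    refine mem_range_of_fixed fun g => ?_
    rw [map_div₀, map_sub, hw, hw, map_mul, map_root, map_ofNat]
    rcases zmod_two_cases (kummerFun v g) with h | h
    · simp [h]
    · simp only [h, e1, sgn_one, zero_add]
      field_simp
      ring
  refine ⟨⟨x, y⟩, fun j => ?_⟩
  rw [eval_apply, hx, hy]
  rcases zmod_two_cases j with rfl | rfl
  · simp only [sgn_zero]
    field_simp
    ring
  · simp only [sgn_one]
    field_simp
    ring

/-- The function `(i, j) ↦ z(i, j)` on `F_{u,v}`, where `√u, √v` are evaluated at `(-1)^i`, `(-1)^j`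
times the chosen roots. -/
def eval₂ (hF : ringChar F ≠ 2) (u v : Fˣ) (i j : ZMod 2) (z : BiquadExt u v) :
    SeparableClosure F :=
  eval hF v j z.re + eval hF v j z.im * (sgn _ i * root hF u)

section Eval₂

variable (hF : ringChar F ≠ 2) {u v : Fˣ} (i j : ZMod 2)

theorem eval₂_mul (y z : BiquadExt u v) :
    eval₂ hF u v i j (y * z) = eval₂ hF u v i j y * eval₂ hF u v i j z := by
  have h := root_sq hF u
  have h' := sgn_sq (R := SeparableClosure F) i
  simp only [eval₂, QuadraticAlgebra.re_mul, QuadraticAlgebra.im_mul, map_add, map_mul,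
    AlgHom.commutes, map_zero]
  linear_combination (-eval hF v j y.im * eval hF v j z.im) *
    (sgn _ i ^ 2 * h + algebraMap F _ (u : F) * h')

theorem eval₂_one : eval₂ hF u v i j 1 = 1 := by
  have h : (1 : BiquadExt u v) = ⟨1, 0⟩ := rfl
  simp [eval₂, h]

theorem eval₂_sq (z : BiquadExt u v) : eval₂ hF u v i j (z ^ 2) = eval₂ hF u v i j z ^ 2 := by
  rw [sq, sq, eval₂_mul]

theorem eval₂_unit_ne_zero (z : (BiquadExt u v)ˣ) : eval₂ hF u v i j (z : BiquadExt u v) ≠ 0 := by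
  intro h
  have := eval₂_mul hF i j (z : BiquadExt u v) ((z⁻¹ : (BiquadExt u v)ˣ) : BiquadExt u v)
  rw [Units.mul_inv, eval₂_one, h, zero_mul] at this
  exact one_ne_zero this

theorem eval_unit_ne_zero (z : (QuadExt v)ˣ) : eval hF v j (z : QuadExt v) ≠ 0 :=
  (z.isUnit.map (eval hF v j)).ne_zero

theorem eval₂_inclRight (z : QuadExt v) :
    eval₂ hF u v i j (inclRight u v z) = eval hF v j z := by
  have h : inclRight u v z = ⟨z, 0⟩ := rfl
  simp [eval₂, h]

theorem eval₂_inclLeft (z : QuadExt u) :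
    eval₂ hF u v i j (inclLeft u v z) = eval hF u i z := by
  have h : inclLeft u v z = ⟨algebraMap F _ z.re, algebraMap F _ z.im⟩ := rfl
  simp [eval₂, h, eval_apply hF u]

theorem eval₂_algebraMap (x : F) :
    eval₂ hF u v i j (algebraMap F (BiquadExt u v) x) = algebraMap F _ x := by
  rw [← AlgHom.commutes (inclRight u v), eval₂_inclRight, AlgHom.commutes]

theorem eval₂_sigmaLeft (z : BiquadExt u v) :
    eval₂ hF u v i j (sigmaLeft u v z) = eval₂ hF u v (i + 1) j z := by
  have h : sigmaLeft u v z = ⟨z.re, -z.im⟩ := rfl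
  simp [eval₂, h, sgn_add]

theorem eval₂_sigmaRight (z : BiquadExt u v) :
    eval₂ hF u v i j (sigmaRight u v z) = eval₂ hF u v i (j + 1) z := by
  have h : sigmaRight u v z = ⟨⟨z.re.re, -z.re.im⟩, ⟨z.im.re, -z.im.im⟩⟩ := rfl
  simp [eval₂, h, sgn_add, eval_apply hF v]

theorem map_eval₂ (z : BiquadExt u v) (g : AbsGal F) :
    g (eval₂ hF u v i j z) = eval₂ hF u v (i + kummerFun u g) (j + kummerFun v g) z := by
  simp only [eval₂, map_add, map_mul, map_eval, map_sgn, map_root, sgn_add]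
  ring

theorem quadExt_norm_eq {R : Type*} [CommRing R] {r : R} (z : QuadraticAlgebra R r 0) :
    Algebra.norm R z = z.re ^ 2 - r * z.im ^ 2 := by
  have : Algebra.norm R z = z.norm := QuadraticAlgebra.det_toLinearMap_eq_norm z
  rw [this, QuadraticAlgebra.norm_def]
  ring

theorem algebraMap_norm_eq (z : QuadExt v) :
    algebraMap F _ (Algebra.norm F z) = eval hF v 0 z * eval hF v 1 z := by
  have h := root_sq hF v
  rw [quadExt_norm_eq, eval_apply, eval_apply]
  simp only [map_sub, map_mul, map_pow, sgn_zero, sgn_one]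
  linear_combination (algebraMap F _ z.im) ^ 2 * h

theorem eval_norm_eq (z : BiquadExt u v) :
    eval hF v j (Algebra.norm (QuadExt v) z) = eval₂ hF u v 0 j z * eval₂ hF u v 1 j z := by
  have h := root_sq hF u
  rw [quadExt_norm_eq, eval₂, eval₂]
  simp only [map_sub, map_mul, map_pow, sgn_zero, sgn_one, AlgHom.commutes]
  linear_combination (eval hF v j z.im) ^ 2 * h

theorem eval₂_ext {y z : BiquadExt u v}
    (h : ∀ i j, eval₂ hF u v i j y = eval₂ hF u v i j z) : y = z := by
  have h2 := sepClosure_two_ne_zero hF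
  have hr := root_ne_zero hF u
  have hj : ∀ j, eval hF v j y.re = eval hF v j z.re ∧ eval hF v j y.im = eval hF v j z.im := by
    intro j
    have h0 := h 0 j
    have h1 := h 1 j
    simp only [eval₂, sgn_zero, sgn_one] at h0 h1
    exact ⟨mul_left_cancel₀ h2 (by linear_combination h0 + h1),
      mul_left_cancel₀ (mul_ne_zero h2 hr) (by linear_combination h0 - h1)⟩
  exact QuadraticAlgebra.ext (eval_ext hF fun j => (hj j).1) (eval_ext hF fun j => (hj j).2)

end Eval₂

/-- Galois descent for `F_{u,v}`. -/
theorem exists_eval₂_eq (hF : ringChar F ≠ 2) (u v : Fˣ)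
    (w : ZMod 2 → ZMod 2 → SeparableClosure F)
    (hw : ∀ (g : AbsGal F) i j, g (w i j) = w (i + kummerFun u g) (j + kummerFun v g)) :
    ∃ z : BiquadExt u v, ∀ i j, eval₂ hF u v i j z = w i j := by
  have h2 := sepClosure_two_ne_zero hF
  have hr := root_ne_zero hF u
  have e1 : (1 : ZMod 2) + 1 = 0 := rfl
  obtain ⟨x, hx⟩ := exists_eval_eq hF v (fun j => (w 0 j + w 1 j) / 2) (fun g j => by
    rw [map_div₀, map_add, hw, hw, map_ofNat]
    rcases zmod_two_cases (kummerFun u g) with h | h <;> simp [h, e1, add_comm])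
  obtain ⟨y, hy⟩ := exists_eval_eq hF v (fun j => (w 0 j - w 1 j) / (2 * root hF u)) (fun g j => by
    rw [map_div₀, map_sub, hw, hw, map_mul, map_root, map_ofNat]
    rcases zmod_two_cases (kummerFun u g) with h | h
    · simp [h]
    · simp only [h, e1, sgn_one, zero_add]
      field_simp
      ring)
  refine ⟨⟨x, y⟩, fun i j => ?_⟩
  rw [eval₂, hx, hy]
  rcases zmod_two_cases i with rfl | rfl
  · simp only [sgn_zero]
    field_simp
    ring
  · simp only [sgn_one]
    field_simp
    ring

/-- Descent for units: a nowhere vanishing equivariant function comes from a unit of `F_{u,v}`. -/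
theorem exists_unit_eval₂_eq (hF : ringChar F ≠ 2) (u v : Fˣ)
    (w : ZMod 2 → ZMod 2 → SeparableClosure F) (hw0 : ∀ i j, w i j ≠ 0)
    (hw : ∀ (g : AbsGal F) i j, g (w i j) = w (i + kummerFun u g) (j + kummerFun v g)) :
    ∃ z : (BiquadExt u v)ˣ, ∀ i j, eval₂ hF u v i j (z : BiquadExt u v) = w i j := by
  obtain ⟨z, hz⟩ := exists_eval₂_eq hF u v w hw
  obtain ⟨y, hy⟩ := exists_eval₂_eq hF u v (fun i j => (w i j)⁻¹) (fun g i j => by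
    rw [map_inv₀, hw])
  have hzy : z * y = 1 := eval₂_ext hF fun i j => by
    rw [eval₂_mul, hz, hy, eval₂_one, mul_inv_cancel₀ (hw0 i j)]
  exact ⟨⟨z, y, hzy, by rw [mul_comm, hzy]⟩, hz⟩

/-! ### Monomial descent and Kummer theory -/

/-- Multiplicative Hilbert 90 for a quadratic character `s` of a closed subgroup `H`. -/
theorem exists_eigenvector (H : Set (AbsGal F))
    (hmul : ∀ g ∈ H, ∀ h ∈ H, g * h ∈ H) (hinv : ∀ g ∈ H, g⁻¹ ∈ H) (hone : 1 ∈ H)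
    (s : AbsGal F → ZMod 2) (hs : ∀ g ∈ H, ∀ h ∈ H, s (g * h) = s g + s h)
    (hclosed : IsClosed {g | g ∈ H ∧ s g = 0}) :
    ∃ t : SeparableClosure F, t ≠ 0 ∧ ∀ g ∈ H, g t = sgn _ (s g) * t := by
  by_cases htriv : ∀ g ∈ H, s g = 0
  · exact ⟨1, one_ne_zero, fun g hg => by simp [htriv g hg]⟩
  push Not at htriv
  obtain ⟨σ, hσ, hsσ⟩ := htriv
  have hsσ1 : s σ = 1 := (zmod_two_cases _).resolve_left hsσ
  have hs1 : s 1 = 0 := by simpa using hs 1 hone 1 hone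
  have hsinv : ∀ g ∈ H, s g⁻¹ = s g := by
    intro g hg
    have := hs g hg g⁻¹ (hinv g hg)
    rw [mul_inv_cancel, hs1] at this
    exact (CharTwo.add_eq_zero.mp this.symm).symm
  let K : ClosedSubgroup (AbsGal F) :=
    { carrier := {g | g ∈ H ∧ s g = 0}
      mul_mem' := fun {g h} hg hh =>
        ⟨hmul g hg.1 h hh.1, by rw [hs g hg.1 h hh.1, hg.2, hh.2, add_zero]⟩
      one_mem' := ⟨hone, hs1⟩
      inv_mem' := fun {g} hg => ⟨hinv g hg.1, by rw [hsinv g hg.1, hg.2]⟩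
      isClosed' := hclosed }
  have hfix := InfiniteGalois.fixingSubgroup_fixedField K
  have hσK : σ ∉ (IntermediateField.fixedField K.toSubgroup).fixingSubgroup := by
    rw [hfix]
    exact fun h => hsσ h.2
  rw [IntermediateField.mem_fixingSubgroup_iff] at hσK
  push Not at hσK
  obtain ⟨x, hx, hne⟩ := hσK
  have hx' : ∀ g ∈ H, s g = 0 → g x = x := fun g hg hg0 =>
    (IntermediateField.mem_fixedField_iff _ _).mp hx g ⟨hg, hg0⟩
  -- An element of `H` acts on `x` through the class of `s`.
  have hodd : ∀ g ∈ H, s g = 1 → g x = σ x := by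
    intro g hg hg1
    have := hx' (σ⁻¹ * g) (hmul _ (hinv σ hσ) _ hg) (by
      rw [hs _ (hinv σ hσ) _ hg, hsinv σ hσ, hsσ1, hg1]; rfl)
    have := congrArg σ this
    rwa [← AlgEquiv.mul_apply, mul_inv_cancel_left] at this
  refine ⟨x - σ x, fun h => hne (sub_eq_zero.mp h).symm, fun g hg => ?_⟩
  rw [map_sub, ← AlgEquiv.mul_apply]
  have hgσ := hs g hg σ hσ
  rw [hsσ1] at hgσ
  rcases zmod_two_cases (s g) with h | h
  · rw [hx' g hg h, hodd _ (hmul g hg σ hσ) (by rw [hgσ, h, zero_add]), h]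
    simp
  · rw [hodd g hg h, hx' _ (hmul g hg σ hσ) (by rw [hgσ, h]; rfl), h]
    simp

/-- Monomial descent: `Γ_F` acts on the set `A` by translations through `π`, and `f` is a cocycle
with values in the functions `A → ℤ/2`. The twist of the étale algebra of functions on `A` by the
signs of `f` contains a nowhere vanishing invariant. -/
theorem exists_monomial_basis {A : Type*} [AddCommGroup A]
    (π : AbsGal F → A) (hπ : ∀ g h, π (g * h) = π g + π h)
    (hπc : IsClosed {g | π g = 0})
    (f : AbsGal F → A → ZMod 2) (hf : ∀ g h x, f (g * h) x = f h x + f g (π h + x))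
    (hfc : ∀ x, Continuous fun g => f g x) :
    ∃ τ : A → SeparableClosure F, (∀ x, τ x ≠ 0) ∧
      ∀ g x, g (τ x) = sgn _ (f g x) * τ (π g + x) := by
  have hπ1 : π 1 = 0 := by simpa using hπ 1 1
  have hπinv : ∀ g, π g⁻¹ = - π g := by
    intro g
    have := hπ g⁻¹ g
    rw [inv_mul_cancel, hπ1] at this
    exact eq_neg_of_add_eq_zero_left this.symm
  have hstab : ∀ x : A, ∃ t : SeparableClosure F, t ≠ 0 ∧
      ∀ g ∈ {g | π g = 0}, g t = sgn _ (f g x) * t := by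
    intro x
    refine exists_eigenvector {g | π g = 0} ?_ ?_ hπ1 (fun g => f g x) ?_ ?_
    · intro g hg h hh
      rw [Set.mem_ofPred_eq] at *
      rw [hπ, hg, hh, add_zero]
    · intro g hg
      rw [Set.mem_ofPred_eq] at *
      rw [hπinv, hg, neg_zero]
    · intro g _ h hh
      rw [Set.mem_ofPred_eq] at hh
      rw [hf, hh, zero_add, add_comm]
    · exact hπc.inter (isClosed_singleton.preimage (hfc x) : IsClosed {g | f g x = 0})
  choose t ht0 ht using hstab
  -- Choose a base point `r x` in every orbit, and `k x` moving it to `x`.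
  let S : Setoid A :=
    { r := fun x y => ∃ g, π g + x = y
      iseqv := ⟨fun x => ⟨1, by rw [hπ1, zero_add]⟩,
        fun {x y} ⟨g, hg⟩ => ⟨g⁻¹, by rw [hπinv, ← hg, neg_add_cancel_left]⟩,
        fun {x y z} ⟨g, hg⟩ ⟨h, hh⟩ => ⟨h * g, by rw [hπ, add_assoc, hg, hh]⟩⟩ }
  let r : A → A := fun x => (Quotient.mk S x).out
  have hr : ∀ x, ∃ g, π g + r x = x := fun x => Quotient.mk_out (s := S) x
  have hrS : ∀ g x, r (π g + x) = r x := fun g x => by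
    have : Quotient.mk S (π g + x) = Quotient.mk S x := (Quotient.sound (s := S) ⟨g, rfl⟩).symm
    simp only [r, this]
  choose k hk using hr
  have hf1 : ∀ x, f 1 x = 0 := by
    intro x
    have := hf 1 1 x
    rw [mul_one, hπ1, zero_add] at this
    simpa using this
  refine ⟨fun x => sgn _ (f (k x) (r x)) * k x (t (r x)), fun x => ?_, fun g x => ?_⟩
  · exact mul_ne_zero (sgn_ne_zero _) ((map_ne_zero _).mpr (ht0 _))
  · have hkk := hk (π g + x)
    simp only [hrS] at hkk ⊢
    set y := r x
    set k' := k (π g + x)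
    -- `g k(x)` and `k'` both move `y` to `π g + x`.
    have hstab : π (k'⁻¹ * (g * k x)) = 0 := by
      have h1 : π (g * k x) + y = π k' + y := by rw [hπ, add_assoc, hk x, hkk]
      rw [hπ, hπinv, add_right_cancel h1, neg_add_cancel]
    have hact := ht y (k'⁻¹ * (g * k x)) hstab
    have hact' : g (k x (t y)) = sgn _ (f (k'⁻¹ * (g * k x)) y) * k' (t y) := by
      have := congrArg k' hact
      rw [← AlgEquiv.mul_apply, mul_inv_cancel_left, map_mul, map_sgn] at this
      rw [← this, AlgEquiv.mul_apply]
    have hfeq : f (k x) y + f g x = f (k'⁻¹ * (g * k x)) y + f k' y := by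
      have h1 := hf k' (k'⁻¹ * (g * k x)) y
      rw [mul_inv_cancel_left, hstab, zero_add, hf, hk x] at h1
      exact h1
    have hsg := congrArg (sgn (SeparableClosure F)) hfeq
    rw [sgn_add, sgn_add] at hsg
    rw [map_mul, map_sgn, hact']
    have e1 := sgn_mul_self (R := SeparableClosure F) (f (k x) y)
    have e2 := sgn_mul_self (R := SeparableClosure F) (f (k'⁻¹ * (g * k x)) y)
    have e3 := sgn_mul_self (R := SeparableClosure F) (f k' y)
    have key : sgn (SeparableClosure F) (f (k x) y) * sgn _ (f (k'⁻¹ * (g * k x)) y) =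
        sgn _ (f g x) * sgn _ (f k' y) := by
      linear_combination (sgn (SeparableClosure F) (f (k x) y) * sgn _ (f k' y)) * (-hsg) +
        (sgn (SeparableClosure F) (f g x) * sgn _ (f k' y)) * e1 -
        (sgn (SeparableClosure F) (f (k x) y) * sgn _ (f (k'⁻¹ * (g * k x)) y)) * e3
    linear_combination k' (t y) * key

theorem isClosed_kummerFun (u : Fˣ) : IsClosed {g : AbsGal F | kummerFun u g = 0} :=
  isClosed_singleton.preimage (continuous_kummerFun u)

/-- Kummer theory: every quadratic character of `Γ_F` is the character of an element of `Fˣ`. -/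
theorem exists_eq_kummerFun (hF : ringChar F ≠ 2) (s : AbsGal F → ZMod 2)
    (hs : ∀ g h, s (g * h) = s g + s h) (hc : Continuous s) : ∃ u : Fˣ, kummerFun u = s := by
  obtain ⟨τ, hτ0, hτ⟩ := exists_monomial_basis (A := PUnit.{1}) (fun _ => 0)
    (fun _ _ => rfl) (by simp) (fun g _ => s g) (fun g h _ => by rw [hs, add_comm]) (fun _ => hc)
  obtain ⟨x, hx⟩ : ∃ x : F, algebraMap F _ x = τ 0 ^ 2 := mem_range_of_fixed fun g => by
    rw [map_pow, hτ, mul_pow, sgn_sq, one_mul]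
  have hx0 : x ≠ 0 := by
    rintro rfl
    rw [map_zero] at hx
    exact hτ0 0 (pow_eq_zero_iff two_ne_zero |>.mp hx.symm)
  refine ⟨Units.mk0 x hx0, funext fun g => (eq_kummerFun hF (hτ0 0) ?_ (hτ g 0)).symm⟩
  exact hx.symm

theorem eqModSquares_of_kummerFun_eq (hF : ringChar F ≠ 2) {u v : Fˣ}
    (h : (kummerFun u : AbsGal F → ZMod 2) = kummerFun v) : EqModSquares u v := by
  obtain ⟨z, hz⟩ : ∃ z : F, algebraMap F _ z = root hF u / root hF v :=
    mem_range_of_fixed fun g => by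
      rw [map_div₀, map_root, map_root, h, mul_div_mul_left _ _ (sgn_ne_zero _)]
  have hz0 : z ≠ 0 := by
    rintro rfl
    rw [map_zero] at hz
    exact div_ne_zero (root_ne_zero hF u) (root_ne_zero hF v) hz.symm
  refine ⟨Units.mk0 z hz0, Units.ext ((algebraMap F (SeparableClosure F)).injective ?_)⟩
  have hv := root_ne_zero hF v
  simp only [Units.val_mul, Units.val_pow_eq_pow_val, Units.val_mk0, map_mul, map_pow, hz,
    ← root_sq hF]
  field_simp

theorem continuous_of_eval {X : Type*} [TopologicalSpace X] (hF : ringChar F ≠ 2)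
    {s : X → ZMod 2} {y : X → SeparableClosure F} (t : SeparableClosure F) (ht : t ≠ 0)
    (h : IsLocallyConstant y) (hs : ∀ x, y x = sgn _ (s x) * t) : Continuous s := by
  refine IsLocallyConstant.continuous ((IsLocallyConstant.iff_exists_open _).mpr fun x => ?_)
  obtain ⟨U, hU, hxU, hc⟩ := (IsLocallyConstant.iff_exists_open _).mp h x
  refine ⟨U, hU, hxU, fun x' hx' => sgn_injective (sepClosure_two_ne_zero hF)
    (mul_right_cancel₀ ht ?_)⟩
  rw [← hs, ← hs, hc x' hx']

/-- The action of `Γ_F` on the separable closure is locally constant. -/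
theorem isLocallyConstant_apply (t : SeparableClosure F) :
    IsLocallyConstant fun g : AbsGal F => g t := by
  refine (IsLocallyConstant.iff_exists_open _).mpr fun g => ?_
  have ho : IsOpen (MulAction.stabilizer (AbsGal F) t : Set (AbsGal F)) :=
    stabilizer_isOpen_of_isIntegral (K := F) t
  refine ⟨(fun h => g⁻¹ * h) ⁻¹' (MulAction.stabilizer (AbsGal F) t : Set (AbsGal F)),
    ho.preimage (continuous_const_mul g⁻¹), by simp, fun h hh => ?_⟩
  have h' : (g⁻¹ * h) t = t := hh
  rw [AlgEquiv.mul_apply] at h'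
  have := congrArg g h'
  rwa [← AlgEquiv.mul_apply, mul_inv_cancel, AlgEquiv.one_apply] at this

/-! ### Triple Massey products and norms -/

theorem zmod_two_eq_add_of_add_eq {x y z : ZMod 2} (h : x + y = z) : y = x + z := by
  rw [← h, ← add_assoc, CharTwo.add_self_eq_zero, zero_add]

/-- `φ` is a continuous 1-cochain with `∂φ = χ_b ∪ χ_c`. -/
structure IsLift (b c : Fˣ) (φ : AbsGal F → ZMod 2) : Prop where
  continuous : Continuous φ
  map_mul : ∀ g h, φ (g * h) = φ g + φ h + kummerFun b g * kummerFun c h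

/-- For a given `φ` with `∂φ = χ_b ∪ χ_c`, the triple Massey product `⟨a, b, c⟩` vanishes for a
defining system whose second entry is `φ`: there are `ψ` and `m` with `∂ψ = χ_a ∪ χ_b` and
`∂m = χ_a ∪ φ + ψ ∪ χ_c`. -/
def TripleVanishes (a b c : Fˣ) (φ : AbsGal F → ZMod 2) : Prop :=
  ∃ ψ m : AbsGal F → ZMod 2, IsLift a b ψ ∧ Continuous m ∧
    ∀ g h, m (g * h) = m g + m h + (kummerFun a g * φ h + ψ g * kummerFun c h)

/-- The monomial two-dimensional representation with matrix entries given by `φ`, `χ_b`, `χ_c`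
is realised by square roots `t 0`, `t 1` of the two conjugates of `γ ∈ F_c`. If `b`, `c`, `bc` are not
squares, `√b`, `√c` and `√γ` generate the dihedral extension attached to `φ`. -/
def Presents (hF : ringChar F ≠ 2) (b c : Fˣ) (φ : AbsGal F → ZMod 2) (γ : (QuadExt c)ˣ) : Prop :=
  ∃ t : ZMod 2 → SeparableClosure F, (∀ j, t j ^ 2 = eval hF c j (γ : QuadExt c)) ∧
    ∀ g j, g (t j) = sgn _ (φ g + j * kummerFun b g) * t (j + kummerFun c g)

theorem ne_zero_of_sq_eq_eval {hF : ringChar F ≠ 2} {c : Fˣ} {γ : (QuadExt c)ˣ} {j : ZMod 2}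
    {t : SeparableClosure F} (h : t ^ 2 = eval hF c j (γ : QuadExt c)) : t ≠ 0 := by
  rintro rfl
  exact eval_unit_ne_zero hF j γ (by rw [← h]; simp)

theorem IsLift.inv {b c : Fˣ} {φ : AbsGal F → ZMod 2} (hF : ringChar F ≠ 2) (h : IsLift b c φ) :
    IsLift c b (fun g => φ g⁻¹) where
  continuous := h.continuous.comp continuous_inv
  map_mul g g' := by
    rw [mul_inv_rev, h.map_mul, kummerFun_inv_apply hF, kummerFun_inv_apply hF]
    ring

theorem IsLift.map_inv {b c : Fˣ} {φ : AbsGal F → ZMod 2} (hF : ringChar F ≠ 2)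
    (h : IsLift b c φ) (g : AbsGal F) : φ g⁻¹ = φ g + kummerFun b g * kummerFun c g := by
  have h1 := h.map_mul 1 1
  have hk : kummerFun b (1 : AbsGal F) = 0 := by simpa using kummerFun_mul_apply hF b 1 1
  rw [mul_one, hk, zero_mul, add_zero] at h1
  have h2 := h.map_mul g g⁻¹
  rw [mul_inv_cancel, kummerFun_inv_apply hF, show φ 1 = 0 by simpa using h1] at h2
  grind

theorem IsLift.add_kummerFun {b c : Fˣ} {φ : AbsGal F → ZMod 2} (hF : ringChar F ≠ 2)
    (h : IsLift b c φ) (y : Fˣ) : IsLift b c (fun g => φ g + kummerFun y g) where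
  continuous := h.continuous.add (continuous_kummerFun y)
  map_mul g g' := by
    rw [h.map_mul, kummerFun_mul_apply hF]
    ring

/-- Two cochains with the same coboundary differ by a quadratic character. -/
theorem IsLift.exists_eq_add {b c : Fˣ} {φ φ' : AbsGal F → ZMod 2} (hF : ringChar F ≠ 2)
    (h : IsLift b c φ) (h' : IsLift b c φ') : ∃ y : Fˣ, ∀ g, φ g = φ' g + kummerFun y g := by
  obtain ⟨y, hy⟩ := exists_eq_kummerFun hF (fun g => φ g - φ' g) (fun g g' => by
    rw [h.map_mul, h'.map_mul]
    ring) (h.continuous.sub h'.continuous)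
  exact ⟨y, fun g => by rw [hy]; ring⟩

theorem isLocallyConstant_comp_kummerFun {X : Type*} (u : Fˣ) (w : ZMod 2 → X) :
    IsLocallyConstant fun g : AbsGal F => w (kummerFun u g) :=
  ((IsLocallyConstant.iff_continuous _).mpr (continuous_kummerFun u)).comp w

/-- If `γ ∈ F_c` has norm `b` up to squares, it presents some `φ` with `∂φ = χ_b ∪ χ_c`. -/
theorem exists_isLift_presents (hF : ringChar F ≠ 2) {b c : Fˣ} (γ : (QuadExt c)ˣ)
    (hγ : EqModSquares (Units.map (Algebra.norm F : QuadExt c →* F) γ) b) :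
    ∃ φ, IsLift b c φ ∧ Presents hF b c φ γ := by
  obtain ⟨z, hz⟩ := hγ
  have hN : eval hF c 0 (γ : QuadExt c) * eval hF c 1 (γ : QuadExt c) =
      (root hF b * algebraMap F _ (z : F)) ^ 2 := by
    rw [← algebraMap_norm_eq, mul_pow, root_sq, ← map_pow, ← map_mul]
    congr 1
    simpa using congrArg Units.val hz
  have hbz : root hF b * algebraMap F (SeparableClosure F) (z : F) ≠ 0 :=
    mul_ne_zero (root_ne_zero hF b) (algebraMap_unit_ne_zero z)
  obtain ⟨s, hs⟩ := exists_sq_eq hF (eval hF c 0 (γ : QuadExt c))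
  have hs0 := ne_zero_of_sq_eq_eval hs
  obtain ⟨t, ht0, ht1⟩ : ∃ t : ZMod 2 → SeparableClosure F, t 0 = s ∧
      t 1 = root hF b * algebraMap F _ (z : F) / s :=
    ⟨fun j => if j = 0 then s else root hF b * algebraMap F _ (z : F) / s, by simp, by simp⟩
  have htsq : ∀ j, t j ^ 2 = eval hF c j (γ : QuadExt c) := by
    intro j
    rcases zmod_two_cases j with rfl | rfl
    · rw [ht0, hs]
    · rw [ht1, div_pow, ← hN, hs]
      have := eval_unit_ne_zero hF 0 γ
      field_simp
  have htne : ∀ j, t j ≠ 0 := fun j => ne_zero_of_sq_eq_eval (htsq j)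
  have htt : ∀ j, t j * t (j + 1) = root hF b * algebraMap F _ (z : F) := by
    have e1 : (1 : ZMod 2) + 1 = 0 := rfl
    intro j
    rcases zmod_two_cases j with rfl | rfl
    · rw [zero_add, ht0, ht1]
      field_simp
    · rw [e1, ht0, ht1]
      field_simp
  have hex : ∀ (g : AbsGal F) j, ∃ x, g (t j) = sgn _ x * t (j + kummerFun c g) := by
    intro g j
    apply exists_sgn_of_sq_eq
    rw [← map_pow, htsq, htsq, map_eval]
  choose f hf using hex
  have hinj := sgn_injective (sepClosure_two_ne_zero hF)
  have hf1 : ∀ g j, f g (j + 1) = f g j + kummerFun b g := by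
    intro g j
    have h := congrArg g (htt j)
    rw [map_mul, map_mul, hf, hf, map_root, AlgEquiv.commutes, mul_mul_mul_comm, ← sgn_add,
      add_right_comm j 1, htt, mul_assoc] at h
    exact zmod_two_eq_add_of_add_eq (hinj (mul_right_cancel₀ hbz h))
  have hfj : ∀ g j, f g j = f g 0 + j * kummerFun b g := by
    intro g j
    rcases zmod_two_cases j with rfl | rfl
    · ring
    · rw [← hf1 g 0 |>.trans (by ring : _ = f g 0 + 1 * kummerFun b g), zero_add]
  refine ⟨fun g => f g 0, ⟨?_, fun g h => ?_⟩, t, htsq, fun g j => by rw [hf, hfj]⟩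
  · refine continuous_of_eval hF 1 one_ne_zero (y := fun g => g (t 0) / t (kummerFun c g))
      ((isLocallyConstant_apply (t 0)).div (isLocallyConstant_comp_kummerFun c t)) fun g => ?_
    rw [hf, zero_add, mul_div_cancel_right₀ _ (htne _), mul_one]
  · have hmul : ∀ j, f (g * h) j = f h j + f g (j + kummerFun c h) := by
      intro j
      have h1 := hf (g * h) j
      rw [AlgEquiv.mul_apply, hf, map_mul, map_sgn, hf, ← mul_assoc, ← sgn_add,
        kummerFun_mul_apply hF, add_assoc j, add_comm (kummerFun c h)] at h1
      exact (hinj (mul_right_cancel₀ (htne _) h1)).symm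
    have h1 := hmul 0
    rw [hfj g (_ + _)] at h1
    linear_combination h1

/-- Twisting `φ` by the character of `y` scales the presenting element by `y`. -/
theorem Presents.add_kummerFun {hF : ringChar F ≠ 2} {b c : Fˣ} {φ : AbsGal F → ZMod 2}
    {γ : (QuadExt c)ˣ} (h : Presents hF b c φ γ) (y : Fˣ) :
    Presents hF b c (fun g => φ g + kummerFun y g)
      (Units.map (algebraMap F (QuadExt c) : F →* QuadExt c) y * γ) := by
  obtain ⟨t, hsq, ht⟩ := h
  refine ⟨fun j => root hF y * t j, fun j => ?_, fun g j => ?_⟩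
  · rw [mul_pow, root_sq, hsq, Units.val_mul, map_mul]
    congr 1
    exact (AlgHom.commutes _ _).symm
  · rw [map_mul, map_root, ht, add_right_comm, sgn_add _ (kummerFun y g)]
    ring

/-- If `φ` is presented by `γ ∈ F_c` and `⟨a, b, c⟩` vanishes through `φ`, then `γ` is a norm
from `F_{a,c}`. -/
theorem exists_norm_eq_of_tripleVanishes {hF : ringChar F ≠ 2} {a b c : Fˣ}
    {φ : AbsGal F → ZMod 2} {γ : (QuadExt c)ˣ} (hφ : IsLift b c φ) (hγ : Presents hF b c φ γ)
    (hT : TripleVanishes a b c φ) :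
    ∃ ε : (BiquadExt a c)ˣ, Algebra.norm (QuadExt c) (ε : BiquadExt a c) = γ := by
  obtain ⟨t, hsq, ht⟩ := hγ
  obtain ⟨ψ, m, hψ, hmc, hm⟩ := hT
  have htne : ∀ j, t j ≠ 0 := fun j => ne_zero_of_sq_eq_eval (hsq j)
  -- The signs form a cocycle because `a, b, c` with the entries `ψ`, `φ`, `m` define a
  -- homomorphism to the unipotent `4 × 4` matrices; the terms `χ_a φ` and `χ_a χ_b` pass from this
  -- cocycle to the one with the arguments in the reversed order.
  obtain ⟨τ, hτ0, hτ⟩ := exists_monomial_basis (A := ZMod 2 × ZMod 2)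
    (fun g => (kummerFun a g, kummerFun c g))
    (fun g h => by simp only [kummerFun_mul_apply hF, Prod.mk_add_mk])
    (by simp only [Prod.mk_eq_zero]; exact (isClosed_kummerFun a).inter (isClosed_kummerFun c))
    (fun g x => m g + kummerFun a g * φ g + x.1 * φ g +
      x.2 * (ψ g + kummerFun a g * kummerFun b g) + x.1 * x.2 * kummerFun b g)
    (fun g h x => by
      simp only [hm, hφ.map_mul, hψ.map_mul, kummerFun_mul_apply hF, Prod.fst_add, Prod.snd_add]
      grind)
    (fun x => by
      have h1 := hφ.continuous
      have h2 := hψ.continuous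
      have h3 := continuous_kummerFun a
      have h4 := continuous_kummerFun b
      fun_prop)
  have hadd : ∀ p x : ZMod 2, τ (p, x) * τ (p + 1, x) = τ (0, x) * τ (1, x) := by
    intro p x
    have e1 : (1 : ZMod 2) + 1 = 0 := rfl
    rcases zmod_two_cases p with rfl | rfl
    · rw [zero_add]
    · rw [e1, mul_comm]
  -- The quotient `z j` is equivariant, so `τ ^ 2 / z` is an element of `F_{a,c}`.
  let z : ZMod 2 → SeparableClosure F := fun j => τ (0, j) * τ (1, j) / t j
  have hz0 : ∀ j, z j ≠ 0 := fun j => div_ne_zero (mul_ne_zero (hτ0 _) (hτ0 _)) (htne j)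
  have hz : ∀ (g : AbsGal F) j, g (z j) = z (j + kummerFun c g) := by
    intro g j
    simp only [z]
    rw [map_div₀, map_mul, hτ, hτ, ht, mul_mul_mul_comm, ← sgn_add, Prod.mk_add_mk,
      Prod.mk_add_mk, add_zero, hadd, add_comm j]
    have hs : sgn (SeparableClosure F) (φ g + j * kummerFun b g) ≠ 0 := sgn_ne_zero _
    rw [show ∀ x y : ZMod 2, m g + kummerFun a g * φ g + 0 * φ g + x + 0 * j * y +
        (m g + kummerFun a g * φ g + 1 * φ g + x + 1 * j * y) = φ g + j * y by
      intro x y; grind]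
    rw [mul_div_mul_left _ _ hs]
  obtain ⟨ε, hε⟩ := exists_unit_eval₂_eq hF a c (fun i j => τ (i, j) ^ 2 / z j)
    (fun i j => div_ne_zero (pow_ne_zero _ (hτ0 _)) (hz0 j)) (fun g i j => by
      rw [map_div₀, map_pow, hτ, hz, mul_pow, sgn_sq, one_mul, Prod.mk_add_mk, add_comm i,
        add_comm j])
  refine ⟨ε, eval_ext hF fun j => ?_⟩
  rw [eval_norm_eq, hε, hε, ← hsq]
  have h1 := hτ0 (0, j)
  have h2 := hτ0 (1, j)
  have h3 := htne j
  simp only [z]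
  field_simp

/-- If `φ` is presented by a norm from `F_{a,c}`, then `⟨a, b, c⟩` vanishes through `φ`. -/
theorem tripleVanishes_of_norm_eq {hF : ringChar F ≠ 2} {a b c : Fˣ}
    {φ : AbsGal F → ZMod 2} {γ : (QuadExt c)ˣ} (hφ : IsLift b c φ) (hγ : Presents hF b c φ γ)
    (ε : (BiquadExt a c)ˣ) (hε : Algebra.norm (QuadExt c) (ε : BiquadExt a c) = γ) :
    TripleVanishes a b c φ := by
  obtain ⟨t, hsq, ht⟩ := hγ
  have htne : ∀ j, t j ≠ 0 := fun j => ne_zero_of_sq_eq_eval (hsq j)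
  have hinj := sgn_injective (sepClosure_two_ne_zero hF)
  have e1 : (1 : ZMod 2) + 1 = 0 := rfl
  have hεt : ∀ j, eval₂ hF a c 0 j (ε : BiquadExt a c) * eval₂ hF a c 1 j (ε : BiquadExt a c) =
      t j ^ 2 := by
    intro j
    rw [← eval_norm_eq, hε, hsq]
  have hε0 := fun i j => eval₂_unit_ne_zero hF i j ε
  have hroot : ∀ j, ∃ s : SeparableClosure F, s ^ 2 = eval₂ hF a c 0 j (ε : BiquadExt a c) :=
    fun j => exists_sq_eq hF _
  choose s hs using hroot
  have hs0 : ∀ j, s j ≠ 0 := by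
    intro j h
    apply hε0 0 j
    rw [← hs, h]
    simp
  obtain ⟨τ, hτl, hτr⟩ : ∃ τ : ZMod 2 → ZMod 2 → SeparableClosure F,
      (∀ j, τ 0 j = s j) ∧ ∀ j, τ 1 j = t j / s j :=
    ⟨fun i j => if i = 0 then s j else t j / s j, by simp, by simp⟩
  have hτsq : ∀ i j, τ i j ^ 2 = eval₂ hF a c i j (ε : BiquadExt a c) := by
    intro i j
    rcases zmod_two_cases i with rfl | rfl
    · rw [hτl, hs]
    · rw [hτr, div_pow, ← hεt, hs]
      have := hε0 0 j
      field_simp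
  have hτ0 : ∀ i j, τ i j ≠ 0 := by
    intro i j h
    apply hε0 i j
    rw [← hτsq, h]
    simp
  have hττ : ∀ i j, τ i j * τ (i + 1) j = t j := by
    intro i j
    have := hs0 j
    rcases zmod_two_cases i with rfl | rfl
    · rw [zero_add, hτl, hτr]
      field_simp
    · rw [e1, hτl, hτr]
      field_simp
  have hex : ∀ (g : AbsGal F) i j, ∃ x,
      g (τ i j) = sgn _ x * τ (i + kummerFun a g) (j + kummerFun c g) := by
    intro g i j
    apply exists_sgn_of_sq_eq
    rw [← map_pow, hτsq, hτsq, map_eval₂]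
  choose f hf using hex
  have hfi : ∀ g i j, f g (i + 1) j = f g i j + (φ g + j * kummerFun b g) := by
    intro g i j
    have h := congrArg g (hττ i j)
    rw [map_mul, hf, hf, ht, mul_mul_mul_comm, ← sgn_add, add_right_comm i 1, hττ] at h
    exact zmod_two_eq_add_of_add_eq (hinj (mul_right_cancel₀ (htne _) h))
  have hform : ∀ g i j, f g i j = f g 0 0 + i * φ g + j * (f g 0 1 + f g 0 0) +
      i * j * kummerFun b g := by
    intro g i j
    have h0 := hfi g 0 0
    have h1 := hfi g 0 1
    rw [zero_add] at h0 h1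
    rcases zmod_two_cases i with rfl | rfl <;> rcases zmod_two_cases j with rfl | rfl <;> grind
  have hmul : ∀ g h i j,
      f (g * h) i j = f h i j + f g (i + kummerFun a h) (j + kummerFun c h) := by
    intro g h i j
    have h1 := hf (g * h) i j
    rw [AlgEquiv.mul_apply, hf, map_mul, map_sgn, hf, ← mul_assoc, ← sgn_add,
      kummerFun_mul_apply hF, kummerFun_mul_apply hF, add_assoc i, add_assoc j,
      add_comm (kummerFun a h), add_comm (kummerFun c h)] at h1
    exact (hinj (mul_right_cancel₀ (hτ0 _ _) h1)).symm
  have hfc : ∀ i j, Continuous fun g => f g i j := by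
    intro i j
    refine continuous_of_eval hF 1 one_ne_zero
      (y := fun g => g (τ i j) / τ (i + kummerFun a g) (j + kummerFun c g))
      ((isLocallyConstant_apply (τ i j)).div ?_) fun g => ?_
    · refine (IsLocallyConstant.iff_continuous _).mpr ?_ |>.comp
        (f := fun g : AbsGal F => (kummerFun a g, kummerFun c g))
        (fun p : ZMod 2 × ZMod 2 => τ (i + p.1) (j + p.2))
      exact (continuous_kummerFun a).prodMk (continuous_kummerFun c)
    · rw [hf, mul_div_cancel_right₀ _ (hτ0 _ _), mul_one]
  have h00 := hfc 0 0
  have h01 := hfc 0 1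
  have ha := continuous_kummerFun a
  have hb := continuous_kummerFun b
  have hφc := hφ.continuous
  -- The same change of cocycle as in the converse, solved for `ψ` and `m`.
  refine ⟨fun g => f g 0 1 + f g 0 0 + kummerFun a g * kummerFun b g,
    fun g => f g 0 0 + kummerFun a g * φ g, ⟨by fun_prop, fun g h => ?_⟩, by fun_prop,
    fun g h => ?_⟩
  · have h1 := hmul g h 0 0
    have h2 := hmul g h 0 1
    rw [hform g (_ + _)] at h1 h2
    simp only [kummerFun_mul_apply hF]
    grind
  · have h1 := hmul g h 0 0
    rw [hform g (_ + _)] at h1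
    simp only [kummerFun_mul_apply hF, hφ.map_mul]
    grind

/-! ### Norm groups -/

theorem isUnit_of_isUnit_norm {R : Type*} [CommRing R] {r : R} {z : QuadraticAlgebra R r 0}
    (h : IsUnit (Algebra.norm R z)) : IsUnit z := by
  rw [QuadraticAlgebra.isUnit_iff_norm_isUnit]
  rwa [show z.norm = Algebra.norm R z from (QuadraticAlgebra.det_toLinearMap_eq_norm z).symm]

theorem mem_normGroup_iff {u y : Fˣ} :
    y ∈ normGroup u ↔ ∃ p q : F, (y : F) = p ^ 2 - u * q ^ 2 := by
  constructor
  · rintro ⟨x, rfl⟩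
    exact ⟨(x : QuadExt u).re, (x : QuadExt u).im, by
      rw [Units.coe_map, quadExt_norm_eq]⟩
  · rintro ⟨p, q, h⟩
    have hn : Algebra.norm F (⟨p, q⟩ : QuadExt u) = y := by rw [quadExt_norm_eq, h]
    obtain ⟨z, hz⟩ := isUnit_of_isUnit_norm (hn ▸ y.isUnit)
    exact ⟨z, Units.ext (by rw [Units.coe_map, hz, hn])⟩

theorem sq_mem_normGroup (u z : Fˣ) : z ^ 2 ∈ normGroup u :=
  mem_normGroup_iff.mpr ⟨z, 0, by simp⟩

theorem neg_self_mem_normGroup (u : Fˣ) : -u ∈ normGroup u :=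
  mem_normGroup_iff.mpr ⟨0, 1, by simp⟩

/-! ### Scalars that are norms from `F_{a,c}` -/

theorem mem_sup_normGroup {a c y m n : Fˣ} (hm : m ∈ normGroup a) (hn : n ∈ normGroup (a * c))
    (h : y = m * n) : y ∈ normGroup a ⊔ normGroup (a * c) :=
  h ▸ Subgroup.mul_mem_sup hm hn

/-- A scalar which is a norm from `F_{a,c}` to `F_c` is the product of a norm from `F_a` and a norm
from `F_{ac}`. -/
theorem mem_sup_of_norm_eq (hF : ringChar F ≠ 2) {a c y : Fˣ} (η : BiquadExt a c)
    (h : Algebra.norm (QuadExt c) η = algebraMap F (QuadExt c) y) :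
    y ∈ normGroup a ⊔ normGroup (a * c) := by
  obtain ⟨⟨x0, x1⟩, ⟨w0, w1⟩⟩ := η
  rw [quadExt_norm_eq] at h
  have hre := congrArg QuadraticAlgebra.re h
  have him := congrArg QuadraticAlgebra.im h
  simp [sq] at hre him
  have ha := a.ne_zero
  have hc := c.ne_zero
  have hy := y.ne_zero
  have h2 : (2 : F) ≠ 0 := Ring.two_ne_zero hF
  have him' : x0 * x1 = a * (w0 * w1) := mul_left_cancel₀ h2 (by linear_combination him)
  by_cases hx0 : x0 = 0
  · -- Then one of `w0`, `w1` vanishes.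
    subst hx0
    have hw : w0 * w1 = 0 := by simpa [ha] using him'.symm
    rcases mul_eq_zero.mp hw with rfl | rfl
    · have hm : (x1 ^ 2 - a * w1 ^ 2 : F) ≠ 0 := by
        intro h0
        apply hy
        linear_combination -hre + c * h0
      refine mem_sup_normGroup (m := -a * Units.mk0 _ hm) (n := -(a * c) * (a⁻¹) ^ 2)
        (mul_mem (neg_self_mem_normGroup a) (mem_normGroup_iff.mpr ⟨x1, w1, rfl⟩))
        (mul_mem (neg_self_mem_normGroup _) (sq_mem_normGroup _ _)) (Units.ext ?_)
      simp
      field_simp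
      linear_combination -hre
    · have hm : (w0 ^ 2 - (a * c : Fˣ) * (x1 / a) ^ 2 : F) ≠ 0 := by
        intro h0
        apply hy
        have : (a : F) * (w0 ^ 2 - (a * c : Fˣ) * (x1 / a) ^ 2) = 0 := by rw [h0, mul_zero]
        simp at this
        field_simp at this
        linear_combination -hre - this
      refine mem_sup_normGroup (m := -a) (n := Units.mk0 _ hm) (neg_self_mem_normGroup a)
        (mem_normGroup_iff.mpr ⟨w0, x1 / a, rfl⟩) (Units.ext ?_)
      simp
      field_simp
      linear_combination -hre
  · have hx1 : x1 = a * (w0 * w1) / x0 := by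
      rw [← him']
      field_simp
    have hy' : (y : F) = (x0 ^ 2 - a * w0 ^ 2) * ((1 : F) ^ 2 - (a * c : Fˣ) * (w1 / x0) ^ 2) := by
      rw [← hre, hx1]
      simp
      field_simp
      ring
    have hmn := hy'.symm ▸ hy
    exact mem_sup_normGroup (m := Units.mk0 _ (left_ne_zero_of_mul hmn))
      (n := Units.mk0 _ (right_ne_zero_of_mul hmn)) (mem_normGroup_iff.mpr ⟨_, _, rfl⟩)
      (mem_normGroup_iff.mpr ⟨_, _, rfl⟩) (Units.ext hy')

theorem exists_norm_eq_of_mem_sup {a c y : Fˣ} (h : y ∈ normGroup a ⊔ normGroup (a * c)) :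
    ∃ η : (BiquadExt a c)ˣ,
      Algebra.norm (QuadExt c) (η : BiquadExt a c) = algebraMap F (QuadExt c) y := by
  obtain ⟨m, hm, n, hn, rfl⟩ := Subgroup.mem_sup.mp h
  obtain ⟨p, q, hpq⟩ := mem_normGroup_iff.mp hm
  obtain ⟨r, s, hrs⟩ := mem_normGroup_iff.mp hn
  have h1 : Algebra.norm (QuadExt c)
      ((⟨⟨p, 0⟩, ⟨q, 0⟩⟩ : BiquadExt a c) * ⟨⟨r, 0⟩, ⟨0, s⟩⟩) =
        algebraMap F (QuadExt c) (m * n : Fˣ) := by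
    rw [_root_.map_mul, quadExt_norm_eq, quadExt_norm_eq, Units.val_mul, hpq, hrs]
    ext
    · simp [sq, -mul_eq_mul_left_iff, -mul_eq_mul_right_iff]; ring
    · simp [sq]
  obtain ⟨z, hz⟩ := isUnit_of_isUnit_norm (h1 ▸ (m * n).isUnit.map (algebraMap F (QuadExt c)))
  exact ⟨z, hz ▸ h1⟩

/-! ### Elements of `F_{a,c}` of prescribed norm modulo squares -/

theorem exists_unit_of_norm_norm_eq {a c y : Fˣ} {ε : BiquadExt a c} {k : F} (hk : k ≠ 0)
    (h : Algebra.norm F (Algebra.norm (QuadExt c) ε) = y * k ^ 2) :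
    ∃ ε' : (BiquadExt a c)ˣ, NormEqModSquares ε' y := by
  have hu : IsUnit (Algebra.norm F (Algebra.norm (QuadExt c) ε)) := by
    rw [h]
    exact y.isUnit.mul ((IsUnit.mk0 k hk).pow 2)
  obtain ⟨z, rfl⟩ := isUnit_of_isUnit_norm (isUnit_of_isUnit_norm hu)
  refine ⟨z, Units.mk0 k hk, Units.ext ?_⟩
  rw [Units.coe_map, ← Algebra.norm_norm (S := QuadExt c), h]
  simp

/-- If `b` is a norm from both `F_a` and `F_c`, it is a norm from `F_{a,c}` modulo squares. -/
theorem exists_normEqModSquares (hF : ringChar F ≠ 2) {a b c : Fˣ} (hab : b ∈ normGroup a)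
    (hcb : b ∈ normGroup c) : ∃ ε : (BiquadExt a c)ˣ, NormEqModSquares ε b := by
  have h2 : (2 : F) ≠ 0 := Ring.two_ne_zero hF
  obtain ⟨p, q, hpq⟩ := mem_normGroup_iff.mp hab
  obtain ⟨r, s, hrs⟩ := mem_normGroup_iff.mp hcb
  -- The sum of elements of norm `b` in `F_a` and `F_c`: its norm is `b` times the square of the
  -- sum of the traces.
  have main : ∀ p : F, (b : F) = p ^ 2 - a * q ^ 2 → p + r ≠ 0 →
      ∃ ε : (BiquadExt a c)ˣ, NormEqModSquares ε b := by
    intro p hp hpr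
    refine exists_unit_of_norm_norm_eq (ε := ⟨⟨p + r, s⟩, ⟨q, 0⟩⟩) (k := 2 * (p + r))
      (mul_ne_zero h2 hpr) ?_
    rw [quadExt_norm_eq, quadExt_norm_eq]
    simp [sq]
    linear_combination ((p + r) ^ 2 + c * s ^ 2 - a * q ^ 2 + 2 * r * (p + r)) * (hrs - hp) -
      4 * (p + r) ^ 2 * hrs
  by_cases hpr : p + r = 0
  · by_cases hpr' : -p + r = 0
    · have hr : r = 0 := mul_left_cancel₀ h2 (by linear_combination hpr + hpr')
      have hp : p = 0 := by linear_combination hpr - hr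
      subst hr hp
      -- Here `ac` is a square, `F_{a,c}` is `F_a × F_a`, and `ε` is an element of norm `b` in one
      -- factor, `1` in the other.
      have hb := b.ne_zero
      have hs : s ≠ 0 := by rintro rfl; exact hb (by rw [hrs]; ring)
      have hc := c.ne_zero
      refine exists_unit_of_norm_norm_eq
        (ε := ⟨⟨1 / 2, s / 2⟩, ⟨q / 2, -q / (2 * (s * c))⟩⟩) (k := 1) one_ne_zero ?_
      rw [quadExt_norm_eq, quadExt_norm_eq]
      have hac : (a : F) * q ^ 2 = c * s ^ 2 := by linear_combination hpq - hrs
      simp [sq]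
      field_simp
      rw [hac, hrs]
      ring
    · exact main (-p) (by rw [hpq]; ring) hpr'
  · exact main p hpq hpr

/-! ### Split quaternion algebras -/

/-- If a matrix algebra over `D` is isomorphic to a matrix algebra over `F`, then `D` is not a
division algebra, unless it is spanned by one element over `F`. -/
theorem exists_not_isUnit_or_forall_mem_range {D : Type*} [Ring D] [Algebra F D]
    {n m : ℕ} (hm : m ≠ 0) (i : Matrix (Fin n) (Fin n) D ≃ₐ[F] Matrix (Fin m) (Fin m) F) :
    (∃ x : D, x ≠ 0 ∧ ¬ IsUnit x) ∨ ∃ d : D, ∀ x : D, ∃ r : F, x = r • d := by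
  have : NeZero m := ⟨hm⟩
  by_contra! hcon
  obtain ⟨hunit, hspan⟩ := hcon
  -- `e` corresponds to an idempotent of rank one, so that `e x e` is a multiple of `e`.
  let E : Matrix (Fin m) (Fin m) F := Matrix.single 0 0 1
  let e := i.symm E
  have he0 : e ≠ 0 := by
    intro h
    have h1 : E = 0 := (map_eq_zero_iff i.symm i.symm.injective).mp h
    have h2 := congrFun (congrFun h1 0) 0
    simp [E] at h2
  have hexe : ∀ x, ∃ r : F, e * x * e = r • e := by
    intro x
    refine ⟨i x 0 0, i.injective ?_⟩
    simp [e, E, Matrix.single_mul_mul_single]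
  obtain ⟨k, l, hkl⟩ : ∃ k l, e k l ≠ 0 := by
    by_contra! h
    exact he0 (Matrix.ext h)
  obtain ⟨d, hd⟩ := hunit _ hkl
  obtain ⟨x, hx⟩ := hspan (d⁻¹ : Dˣ)
  obtain ⟨r, hr⟩ := hexe (Matrix.single l k x)
  have h1 := congrFun (congrFun hr k) l
  have h2 : (e * Matrix.single l k x * e) k l = e k l * x * e k l := by
    simp [Matrix.mul_apply, Matrix.single_apply, Finset.sum_ite_eq, ite_and]
  rw [h2, Matrix.smul_apply, ← hd] at h1
  apply hx r
  have h3 : (d : D) * x = r • (1 : D) := by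
    have := congrArg (· * ((d⁻¹ : Dˣ) : D)) h1
    simpa [mul_assoc] using this
  have h4 := congrArg (((d⁻¹ : Dˣ) : D) * ·) h3
  simpa using h4

theorem exists_isotropic_of_symbol_eq (hF : ringChar F ≠ 2) {a b : Fˣ}
    (h : symbol hF a b = brauerZero F) :
    ∃ x0 x1 x2 x3 : F, ¬ (x0 = 0 ∧ x1 = 0 ∧ x2 = 0 ∧ x3 = 0) ∧
      x0 ^ 2 - a * x1 ^ 2 = b * (x2 ^ 2 - a * x3 ^ 2) := by
  obtain ⟨n, m, -, hm, ⟨i⟩⟩ : IsBrauerEquivalent (quaternionCSA hF a b) (trivialCSA F) :=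
    Quotient.exact h
  have i' : Matrix (Fin n) (Fin n) ℍ[F,(a : F),(b : F)] ≃ₐ[F] Matrix (Fin m) (Fin m) F := i
  rcases exists_not_isUnit_or_forall_mem_range hm i' with ⟨x, hx0, hx⟩ | ⟨d, hd⟩
  · refine ⟨x.re, x.imI, x.imJ, x.imK, fun ⟨h0, h1, h2, h3⟩ =>
      hx0 (QuaternionAlgebra.ext h0 h1 h2 h3), ?_⟩
    by_contra hne
    apply hx
    set N : F := x.re ^ 2 - a * x.imI ^ 2 - b * (x.imJ ^ 2 - a * x.imK ^ 2) with hN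
    have hN0 : N ≠ 0 := fun h0 => hne (sub_eq_zero.mp h0)
    refine ⟨⟨x, N⁻¹ • ⟨x.re, -x.imI, -x.imJ, -x.imK⟩, ?_, ?_⟩, rfl⟩
    · ext
      · simp
        field_simp
        rw [hN]
        ring
      all_goals simp; ring
    · ext
      · simp
        field_simp
        rw [hN]
        ring
      all_goals simp; ring
  · exfalso
    obtain ⟨r, hr⟩ := hd 1
    obtain ⟨s, hs⟩ := hd ⟨0, 1, 0, 0⟩
    rw [QuaternionAlgebra.ext_iff] at hr hs
    simp at hr hs
    grind

/-- A quaternion algebra `(a, b)` that splits has `b` as a norm from `F_a`. -/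
theorem mem_normGroup_of_symbol_eq (hF : ringChar F ≠ 2) {a b : Fˣ}
    (h : symbol hF a b = brauerZero F) : b ∈ normGroup a := by
  have h2 : (2 : F) ≠ 0 := Ring.two_ne_zero hF
  obtain ⟨x0, x1, x2, x3, hne, hx⟩ := exists_isotropic_of_symbol_eq hF h
  have ha := a.ne_zero
  -- If the norm form of `F_a` is isotropic, then `a` is a square and the form is universal.
  have hiso : ∀ s t : F, s ^ 2 - a * t ^ 2 = 0 → ¬ (s = 0 ∧ t = 0) → b ∈ normGroup a := by
    intro s t hst hnz
    have ht : t ≠ 0 := by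
      rintro rfl
      exact hnz ⟨by simpa using hst, rfl⟩
    have hs : s ≠ 0 := by
      rintro rfl
      simp [ha, ht] at hst
    refine mem_normGroup_iff.mpr ⟨(b + 1) / 2, (b - 1) * t / (2 * s), ?_⟩
    have hs2 : (a : F) = s ^ 2 / t ^ 2 := by
      field_simp
      linear_combination -hst
    rw [hs2]
    field_simp
    ring
  by_cases hn : x2 ^ 2 - a * x3 ^ 2 = 0
  · by_cases h23 : x2 = 0 ∧ x3 = 0
    · exact hiso x0 x1 (by rw [hx, hn, mul_zero]) fun h01 => hne ⟨h01.1, h01.2, h23.1, h23.2⟩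
    · exact hiso x2 x3 hn h23
  · refine mem_normGroup_iff.mpr ⟨(x0 * x2 - a * x1 * x3) / (x2 ^ 2 - a * x3 ^ 2),
      (x1 * x2 - x0 * x3) / (x2 ^ 2 - a * x3 ^ 2), ?_⟩
    field_simp
    linear_combination -(x2 ^ 2 - a * x3 ^ 2) * hx

/-- The elementary form of the symmetry `(u, v) = (v, u)`. -/
theorem mem_normGroup_comm {u v : Fˣ} (hF : ringChar F ≠ 2) (h : v ∈ normGroup u) :
    u ∈ normGroup v := by
  have h2 : (2 : F) ≠ 0 := Ring.two_ne_zero hF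
  obtain ⟨p, q, hpq⟩ := mem_normGroup_iff.mp h
  by_cases hq : q = 0
  · have hp : p ≠ 0 := by
      rintro rfl
      exact v.ne_zero (by rw [hpq, hq]; ring)
    refine mem_normGroup_iff.mpr ⟨(u + 1) / 2, (u - 1) / (2 * p), ?_⟩
    rw [hpq, hq]
    field_simp
    ring
  · refine mem_normGroup_iff.mpr ⟨p / q, 1 / q, ?_⟩
    rw [hpq]
    field_simp
    ring

/-! ### Defining systems of fourfold Massey products -/

section Massey

variable {Γ : Type u} [TopologicalSpace Γ]

theorem cup_apply (f h : Cochain Γ 1) (x : Fin 2 → Γ) :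
    cup f h x = f (fun _ => x 0) * h (fun _ => x 1) := by
  have h1 : (fun i : Fin 1 => x (Fin.castAdd 1 i)) = fun _ => x 0 := by
    funext i
    fin_cases i
    rfl
  have h2 : (fun i : Fin 1 => x (Fin.natAdd 1 i)) = fun _ => x 1 := by
    funext i
    fin_cases i
    rfl
  change f (fun i : Fin 1 => x (Fin.castAdd 1 i)) * h (fun i : Fin 1 => x (Fin.natAdd 1 i)) = _
  rw [h1, h2]

/-- The function `Γ → ℤ/2` underlying a 1-cochain. -/
def Cochain.toFun₁ (f : Cochain Γ 1) (g : Γ) : ZMod 2 := f fun _ => g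

theorem Cochain.continuous_toFun₁ (f : Cochain Γ 1) : Continuous f.toFun₁ :=
  f.continuous.comp (by fun_prop)

/-- The 1-cochain with a given underlying function. -/
def Cochain.of (f : Γ → ZMod 2) (hf : Continuous f) : Cochain Γ 1 :=
  ⟨fun x => f (x 0), hf.comp (continuous_apply 0)⟩

variable [Group Γ] [IsTopologicalGroup Γ]

theorem diff_zero_eq_zero (f : Cochain Γ 0) : diff 0 f = 0 := by
  ext g
  simp only [diff, AddMonoidHom.coe_mk, ZeroHom.coe_mk, ContinuousMap.coe_mk]
  rw [Fin.sum_univ_one, Subsingleton.elim (fun i : Fin 0 => g i.succ)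
    (Fin.contractNth (0 : Fin 1) (· * ·) g)]
  simp [CharTwo.add_self_eq_zero]

theorem diff_one_apply (f : Cochain Γ 1) (x : Fin 2 → Γ) :
    diff 1 f x = f (fun _ => x 1) + f (fun _ => x 0 * x 1) + f (fun _ => x 0) := by
  have h0 : Fin.contractNth (0 : Fin 2) (· * ·) x = fun _ => x 0 * x 1 := by
    funext i
    fin_cases i
    rfl
  have h1 : Fin.contractNth (1 : Fin 2) (· * ·) x = fun _ => x 0 := by
    funext i
    fin_cases i
    rfl
  have h2 : (fun i : Fin 1 => x i.succ) = fun _ => x 1 := by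
    funext i
    fin_cases i
    rfl
  simp only [diff, AddMonoidHom.coe_mk, ZeroHom.coe_mk, ContinuousMap.coe_mk]
  rw [Fin.sum_univ_two, h0, h1, h2]
  have hneg : (-1 : ZMod 2) = 1 := rfl
  simp [hneg, add_assoc]

/-- The equation `∂f = s` for the underlying function of `f`. -/
theorem diff_one_eq_iff (f : Cochain Γ 1) (s : Cochain Γ 2) :
    diff 1 f = s ↔ ∀ g h, f.toFun₁ (g * h) = f.toFun₁ g + f.toFun₁ h + s ![g, h] := by
  constructor
  · rintro rfl g h
    rw [diff_one_apply]
    simp only [Cochain.toFun₁, Matrix.cons_val_zero, Matrix.cons_val_one]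
    grind
  · intro H
    ext x
    have hx : x = ![x 0, x 1] := by
      funext i
      fin_cases i <;> rfl
    have := H (x 0) (x 1)
    rw [← hx] at this
    rw [diff_one_apply]
    simp only [Cochain.toFun₁] at this
    grind

end Massey

theorem toFun₁_kummerChar (u : Fˣ) (g : AbsGal F) :
    (kummerChar u).toFun₁ g = kummerFun u g := rfl

theorem diff_kummerChar (hF : ringChar F ≠ 2) (u : Fˣ) : diff 1 (kummerChar u) = 0 := by
  rw [diff_one_eq_iff]
  intro g h
  simp only [toFun₁_kummerChar, kummerFun_mul_apply hF, ContinuousMap.zero_apply, add_zero]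

/-- Reversing the order of the entries: the part of a defining system of `⟨a, b, c, d⟩` above
`⟨b, c, d⟩`, composed with inversion, is a defining system of `⟨d, c, b⟩`. -/
theorem tripleVanishes_inv_iff (hF : ringChar F ≠ 2) {b c d : Fˣ} {φ : AbsGal F → ZMod 2} :
    TripleVanishes d c b (fun g => φ g⁻¹) ↔
      ∃ ψ m : AbsGal F → ZMod 2, IsLift c d ψ ∧ Continuous m ∧
        ∀ g h, m (g * h) = m g + m h + (kummerFun b g * ψ h + φ g * kummerFun d h) := by
  constructor
  · rintro ⟨ψ, m, hψ, hm, h⟩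
    refine ⟨fun g => ψ g⁻¹, fun g => m g⁻¹, hψ.inv hF, hm.comp continuous_inv, fun g g' => ?_⟩
    simp only [mul_inv_rev, h, kummerFun_inv_apply hF, inv_inv]
    ring
  · rintro ⟨ψ, m, hψ, hm, h⟩
    refine ⟨fun g => ψ g⁻¹, fun g => m g⁻¹, hψ.inv hF, hm.comp continuous_inv, fun g g' => ?_⟩
    simp only [mul_inv_rev, h, kummerFun_inv_apply hF]
    ring

/-- The fourfold Massey product is defined iff some `φ` with `∂φ = χ_b ∪ χ_c` makes both
`⟨a, b, c⟩` and `⟨b, c, d⟩` vanish. -/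
theorem masseyDefined_iff (hF : ringChar F ≠ 2) (a b c d : Fˣ) :
    MasseyDefined ![kummerChar a, kummerChar b, kummerChar c, kummerChar d] ↔
      ∃ φ, IsLift b c φ ∧ TripleVanishes a b c φ ∧ TripleVanishes d c b (fun g => φ g⁻¹) := by
  simp only [tripleVanishes_inv_iff hF]
  constructor
  · rintro ⟨M, -, hrep, hdiff⟩
    have hM : ∀ i : Fin 4, M i.castSucc i.succ =
        ![kummerChar a, kummerChar b, kummerChar c, kummerChar d] i := by
      intro i
      obtain ⟨x, hx⟩ := hrep i
      rw [diff_zero_eq_zero] at hx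
      exact (sub_eq_zero.mp hx.symm)
    have h01 : M 0 1 = kummerChar a := hM 0
    have h12 : M 1 2 = kummerChar b := hM 1
    have h23 : M 2 3 = kummerChar c := hM 2
    have h34 : M 3 4 = kummerChar d := hM 3
    have d02 := hdiff 0 2 (by decide) (by decide)
    have d13 := hdiff 1 3 (by decide) (by decide)
    have d24 := hdiff 2 4 (by decide) (by decide)
    have d03 := hdiff 0 3 (by decide) (by decide)
    have d14 := hdiff 1 4 (by decide) (by decide)
    rw [show Finset.Ioo (0 : Fin 5) 2 = {1} by decide, Finset.sum_singleton, h01, h12,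
      diff_one_eq_iff] at d02
    rw [show Finset.Ioo (1 : Fin 5) 3 = {2} by decide, Finset.sum_singleton, h12, h23,
      diff_one_eq_iff] at d13
    rw [show Finset.Ioo (2 : Fin 5) 4 = {3} by decide, Finset.sum_singleton, h23, h34,
      diff_one_eq_iff] at d24
    rw [show Finset.Ioo (0 : Fin 5) 3 = {1, 2} by decide, Finset.sum_pair (by decide), h01, h23,
      diff_one_eq_iff] at d03
    rw [show Finset.Ioo (1 : Fin 5) 4 = {2, 3} by decide, Finset.sum_pair (by decide), h12, h34,
      diff_one_eq_iff] at d14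
    refine ⟨(M 1 3).toFun₁, ⟨(M 1 3).continuous_toFun₁, fun g h => ?_⟩,
      ⟨(M 0 2).toFun₁, (M 0 3).toFun₁, ⟨(M 0 2).continuous_toFun₁, fun g h => ?_⟩,
        (M 0 3).continuous_toFun₁, fun g h => ?_⟩,
      ⟨(M 2 4).toFun₁, (M 1 4).toFun₁, ⟨(M 2 4).continuous_toFun₁, fun g h => ?_⟩,
        (M 1 4).continuous_toFun₁, fun g h => ?_⟩⟩
    · rw [d13, cup_apply]; rfl
    · rw [d02, cup_apply]; rfl
    · rw [d03, ContinuousMap.add_apply, cup_apply, cup_apply]; rfl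
    · rw [d24, cup_apply]; rfl
    · rw [d14, ContinuousMap.add_apply, cup_apply, cup_apply]; rfl
  · rintro ⟨φ, hφ, ⟨ψ, m, hψ, hm, hdm⟩, ⟨ψ', m', hψ', hm', hdm'⟩⟩
    let M : Fin 5 → Fin 5 → Cochain (AbsGal F) 1 :=
      ![![0, kummerChar a, .of ψ hψ.continuous, .of m hm, 0],
        ![0, 0, kummerChar b, .of φ hφ.continuous, .of m' hm'],
        ![0, 0, 0, kummerChar c, .of ψ' hψ'.continuous],
        ![0, 0, 0, 0, kummerChar d],
        ![0, 0, 0, 0, 0]]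
    have hM : ∀ i : Fin 4, M i.castSucc i.succ =
        ![kummerChar a, kummerChar b, kummerChar c, kummerChar d] i := by
      intro i
      fin_cases i <;> rfl
    have d02 : diff 1 (M 0 2) = ∑ l ∈ Finset.Ioo 0 2, cup (M 0 l) (M l 2) := by
      rw [show Finset.Ioo (0 : Fin 5) 2 = {1} by decide, Finset.sum_singleton, diff_one_eq_iff]
      intro g h
      rw [cup_apply]
      exact hψ.map_mul g h
    have d13 : diff 1 (M 1 3) = ∑ l ∈ Finset.Ioo 1 3, cup (M 1 l) (M l 3) := by
      rw [show Finset.Ioo (1 : Fin 5) 3 = {2} by decide, Finset.sum_singleton, diff_one_eq_iff]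
      intro g h
      rw [cup_apply]
      exact hφ.map_mul g h
    have d24 : diff 1 (M 2 4) = ∑ l ∈ Finset.Ioo 2 4, cup (M 2 l) (M l 4) := by
      rw [show Finset.Ioo (2 : Fin 5) 4 = {3} by decide, Finset.sum_singleton, diff_one_eq_iff]
      intro g h
      rw [cup_apply]
      exact hψ'.map_mul g h
    have d03 : diff 1 (M 0 3) = ∑ l ∈ Finset.Ioo 0 3, cup (M 0 l) (M l 3) := by
      rw [show Finset.Ioo (0 : Fin 5) 3 = {1, 2} by decide, Finset.sum_pair (by decide),
        diff_one_eq_iff]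
      intro g h
      rw [ContinuousMap.add_apply, cup_apply, cup_apply]
      exact hdm g h
    have d14 : diff 1 (M 1 4) = ∑ l ∈ Finset.Ioo 1 4, cup (M 1 l) (M l 4) := by
      rw [show Finset.Ioo (1 : Fin 5) 4 = {2, 3} by decide, Finset.sum_pair (by decide),
        diff_one_eq_iff]
      intro g h
      rw [ContinuousMap.add_apply, cup_apply, cup_apply]
      exact hdm' g h
    clear_value M
    refine ⟨M, fun i => ?_, fun i => ?_, fun i j hij hne => ?_⟩
    · rw [hM]
      fin_cases i <;> exact diff_kummerChar hF _
    · rw [hM, sub_self]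
      exact zero_mem _
    · fin_cases i <;> fin_cases j <;> first
        | exact absurd hij (by decide) | exact absurd ⟨rfl, rfl⟩ hne
        | exact d02 | exact d13 | exact d24 | exact d03 | exact d14

/-! ### Comparing the two presentations of `φ` -/

theorem zmod_two_eq_quadratic {κ : ZMod 2 → ZMod 2 → ZMod 2}
    (h : κ 0 0 + κ 1 1 = κ 0 1 + κ 1 0 + 1) (i j : ZMod 2) :
    κ i j = κ 0 0 + i * (κ 1 0 + κ 0 0) + j * (κ 0 1 + κ 0 0) + i * j := by
  rcases zmod_two_cases i with rfl | rfl <;> rcases zmod_two_cases j with rfl | rfl <;> grind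

/-- The scalar `e` measures the difference of the cochains presented by `γ ∈ F_c` and `β ∈ F_b`,
up to the characters of `b` and `c`. -/
theorem exists_eq_of_scalarEquations {hF : ringChar F ≠ 2} {b c : Fˣ}
    {φ φ' : AbsGal F → ZMod 2} (hφ' : IsLift c b φ')
    {γ : (QuadExt c)ˣ} {β : (QuadExt b)ˣ} (hγ : Presents hF b c φ γ) (hβ : Presents hF c b φ' β)
    {e : Fˣ} {ω : (BiquadExt b c)ˣ}
    (h1 : inclRight b c (γ : QuadExt c) * inclLeft b c (β : QuadExt b) =
      algebraMap F (BiquadExt b c) e * (ω : BiquadExt b c) ^ 2)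
    (h2 : subOne (sigmaLeft b c) (subOne (sigmaRight b c) ω) = -1) :
    ∃ l k : ZMod 2, ∀ g, φ g = φ' g⁻¹ + (kummerFun e g + l * kummerFun b g + k * kummerFun c g) := by
  obtain ⟨t, htsq, ht⟩ := hγ
  obtain ⟨s, hssq, hs⟩ := hβ
  have htne : ∀ j, t j ≠ 0 := fun j => ne_zero_of_sq_eq_eval (htsq j)
  have hsne : ∀ j, s j ≠ 0 := fun j => ne_zero_of_sq_eq_eval (hssq j)
  have hinj := sgn_injective (sepClosure_two_ne_zero hF)
  set w : ZMod 2 → ZMod 2 → SeparableClosure F :=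
    fun i j => eval₂ hF b c i j (ω : BiquadExt b c) with hw
  have hwg : ∀ (g : AbsGal F) i j, g (w i j) = w (i + kummerFun b g) (j + kummerFun c g) :=
    fun g i j => map_eval₂ hF i j _ g
  -- The second equation in terms of the conjugates of `ω`.
  have hcross : w 0 0 * w 1 1 = - (w 0 1 * w 1 0) := by
    set η := subOne (sigmaRight b c) ω with hη
    have e1 : (η : BiquadExt b c) * ω = sigmaRight b c ω := by
      have : η * ω = Units.map (sigmaRight b c : BiquadExt b c →* BiquadExt b c) ω := by
        rw [hη, subOne, div_mul_cancel]
      exact congrArg Units.val this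
    have e2 : sigmaLeft b c (η : BiquadExt b c) = -(η : BiquadExt b c) := by
      have : Units.map (sigmaLeft b c : BiquadExt b c →* BiquadExt b c) η = -1 * η := by
        rw [← h2, subOne, div_mul_cancel]
      simpa using congrArg Units.val this
    have e3 := congrArg (eval₂ hF b c 0 0) e1
    have e4 := congrArg (eval₂ hF b c 1 0) e1
    have e5 := congrArg (eval₂ hF b c 0 0) e2
    have e6 : eval₂ hF b c 0 0 (-(η : BiquadExt b c)) = - eval₂ hF b c 0 0 (η : BiquadExt b c) := by
      simp only [eval₂, QuadraticAlgebra.re_neg, QuadraticAlgebra.im_neg, map_neg]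
      ring
    rw [eval₂_mul, eval₂_sigmaRight, zero_add] at e3 e4
    rw [eval₂_sigmaLeft, zero_add, e6] at e5
    rw [e5] at e4
    simp only [hw]
    rw [← e3, ← e4]
    ring
  have hex : ∀ i j, ∃ x, root hF e * w i j = sgn _ x * (t j * s i) := by
    intro i j
    apply exists_sgn_of_sq_eq
    have := congrArg (eval₂ hF b c i j) h1
    rw [eval₂_mul, eval₂_mul, eval₂_inclRight, eval₂_inclLeft, eval₂_algebraMap, eval₂_sq] at this
    rw [mul_pow, root_sq, mul_pow, htsq, hssq, this]
  choose κ hκ using hex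
  -- So `κ` is a quadratic function on `(ℤ/2)²` with leading term `i j`.
  have hsum : κ 0 0 + κ 1 1 = κ 0 1 + κ 1 0 + 1 := by
    have hne : t 0 * s 0 * (t 1 * s 1) ≠ 0 :=
      mul_ne_zero (mul_ne_zero (htne _) (hsne _)) (mul_ne_zero (htne _) (hsne _))
    refine hinj (mul_right_cancel₀ hne ?_)
    rw [sgn_add, sgn_add, sgn_add, sgn_one]
    linear_combination (root hF e) ^ 2 * hcross - (root hF e * w 1 1) * hκ 0 0 -
      sgn _ (κ 0 0) * (t 0 * s 0) * hκ 1 1 - (root hF e * w 1 0) * hκ 0 1 -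
      sgn _ (κ 0 1) * (t 1 * s 0) * hκ 1 0
  have hκf := zmod_two_eq_quadratic hsum
  refine ⟨κ 1 0 + κ 0 0, κ 0 1 + κ 0 0, fun g => ?_⟩
  have h := congrArg g (hκ 0 0)
  rw [map_mul, map_mul, map_mul, map_root, hwg, map_sgn, ht, hs, mul_assoc, hκ] at h
  have h' : kummerFun e g + κ (0 + kummerFun b g) (0 + kummerFun c g) =
      κ 0 0 + (φ g + 0 * kummerFun b g + (φ' g + 0 * kummerFun c g)) := by
    refine hinj (mul_right_cancel₀ (mul_ne_zero (htne (0 + kummerFun c g))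
      (hsne (0 + kummerFun b g))) ?_)
    rw [sgn_add, sgn_add (κ 0 0), sgn_add (φ g + _)]
    linear_combination h
  rw [hκf (_ + _)] at h'
  rw [hφ'.map_inv hF]
  have two : (2 : ZMod 2) = 0 := rfl
  linear_combination -h' - φ' g * two

/-- If the cochains presented by `γ ∈ F_c` and `β ∈ F_b` differ by the character of `e`, then the
equations for `e` and some `ω` hold. -/
theorem exists_scalarEquations {hF : ringChar F ≠ 2} {b c : Fˣ}
    {φ φ' : AbsGal F → ZMod 2} (hφ' : IsLift c b φ')
    {γ : (QuadExt c)ˣ} {β : (QuadExt b)ˣ} (hγ : Presents hF b c φ γ) (hβ : Presents hF c b φ' β)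
    {e : Fˣ} (he : ∀ g, φ g = φ' g⁻¹ + kummerFun e g) :
    ∃ ω : (BiquadExt b c)ˣ,
      inclRight b c (γ : QuadExt c) * inclLeft b c (β : QuadExt b) =
        algebraMap F (BiquadExt b c) e * (ω : BiquadExt b c) ^ 2 ∧
      subOne (sigmaLeft b c) (subOne (sigmaRight b c) ω) = -1 := by
  obtain ⟨t, htsq, ht⟩ := hγ
  obtain ⟨s, hssq, hs⟩ := hβ
  have htne : ∀ j, t j ≠ 0 := fun j => ne_zero_of_sq_eq_eval (htsq j)
  have hsne : ∀ j, s j ≠ 0 := fun j => ne_zero_of_sq_eq_eval (hssq j)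
  have hr := root_ne_zero hF e
  -- The sign `(-1)^(i j)` accounts for the difference `χ_b χ_c` of `φ'` and `φ' ∘ (·)⁻¹`.
  obtain ⟨ω, hω⟩ := exists_unit_eval₂_eq hF b c
    (fun i j => sgn _ (i * j) * (t j * s i) / root hF e)
    (fun i j => div_ne_zero (mul_ne_zero (sgn_ne_zero _) (mul_ne_zero (htne _) (hsne _))) hr)
    (fun g i j => by
      have hz : ∀ x y z p q : ZMod 2, x = y + q * p + z →
          i * j + (x + j * p + (y + i * q)) + z = (i + p) * (j + q) := by
        intro x y z p q h
        rw [h]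
        grind
      have hk := he g
      rw [hφ'.map_inv hF] at hk
      have hz' := congrArg (sgn (SeparableClosure F)) (hz _ _ _ _ _ hk)
      rw [sgn_add, sgn_add, sgn_add _ (φ' g + _)] at hz'
      have hke := sgn_mul_self (R := SeparableClosure F) (kummerFun e g)
      have hke0 : sgn (SeparableClosure F) (kummerFun e g) ≠ 0 := sgn_ne_zero _
      rw [map_div₀, map_mul, map_mul, map_sgn, ht, hs, map_root, ← hz']
      rw [div_eq_div_iff (mul_ne_zero hke0 hr) hr]
      linear_combination -(sgn _ (i * j) * sgn _ (φ g + j * kummerFun b g) *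
        sgn _ (φ' g + i * kummerFun c g) * t (j + kummerFun c g) * s (i + kummerFun b g) *
        root hF e) * hke)
  refine ⟨ω, eval₂_ext hF fun i j => ?_, ?_⟩
  · rw [eval₂_mul, eval₂_mul, eval₂_inclRight, eval₂_inclLeft, eval₂_algebraMap, eval₂_sq, hω,
      ← htsq, ← hssq, div_pow, mul_pow, sgn_sq, root_sq]
    have := algebraMap_unit_ne_zero e
    field_simp
  · have hη : sigmaLeft b c (sigmaRight b c (ω : BiquadExt b c)) * ω =
        -(sigmaRight b c (ω : BiquadExt b c) * sigmaLeft b c (ω : BiquadExt b c)) := by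
      refine eval₂_ext hF fun i j => ?_
      have hneg : ∀ z : BiquadExt b c, eval₂ hF b c i j (-z) = - eval₂ hF b c i j z := by
        intro z
        simp only [eval₂, QuadraticAlgebra.re_neg, QuadraticAlgebra.im_neg, map_neg]
        ring
      rw [hneg, eval₂_mul, eval₂_mul, eval₂_sigmaLeft, eval₂_sigmaRight, eval₂_sigmaRight,
        eval₂_sigmaLeft]
      simp only [hω]
      have hsg : sgn (SeparableClosure F) ((i + 1) * (j + 1)) * sgn _ (i * j) =
          -(sgn _ (i * (j + 1)) * sgn _ ((i + 1) * j)) := by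
        have := congrArg (sgn (SeparableClosure F))
          (show (i + 1) * (j + 1) + i * j = i * (j + 1) + (i + 1) * j + 1 by ring)
        rw [sgn_add, sgn_add, sgn_add, sgn_one] at this
        rw [this]
        ring
      field_simp
      linear_combination (t (j + 1) * s (i + 1) * t j * s i) * hsg
    have hu : Units.map (sigmaLeft b c : BiquadExt b c →* BiquadExt b c)
          (Units.map (sigmaRight b c : BiquadExt b c →* BiquadExt b c) ω) * ω =
        -(Units.map (sigmaRight b c : BiquadExt b c →* BiquadExt b c) ω *
          Units.map (sigmaLeft b c : BiquadExt b c →* BiquadExt b c) ω) := Units.ext hη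
    rw [subOne, subOne, map_div, div_div_eq_mul_div, div_mul_eq_mul_div, hu, neg_div, neg_div,
      mul_div_assoc, mul_div_assoc]
    simp

/-! ### The group of scalars -/

/-- If `φ` is presented by a norm from `F_{a,c}`, the twists of `φ` through which `⟨a, b, c⟩`
vanishes are those by scalars that are norms from `F_{a,c}`. -/
theorem tripleVanishes_add_kummerFun_iff {hF : ringChar F ≠ 2} {a b c : Fˣ}
    {φ : AbsGal F → ZMod 2} (hφ : IsLift b c φ) {ε : (BiquadExt a c)ˣ}
    (hγ : Presents hF b c φ (Units.map (Algebra.norm (QuadExt c) : BiquadExt a c →* QuadExt c) ε))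
    (y : Fˣ) :
    TripleVanishes a b c (fun g => φ g + kummerFun y g) ↔
      y ∈ normGroup a ⊔ normGroup (a * c) := by
  have hpres := hγ.add_kummerFun y
  constructor
  · intro h
    obtain ⟨ε', hε'⟩ := exists_norm_eq_of_tripleVanishes (hφ.add_kummerFun hF y) hpres h
    refine mem_sup_of_norm_eq hF ((ε' / ε : (BiquadExt a c)ˣ) : BiquadExt a c) ?_
    have hN : Units.map (Algebra.norm (QuadExt c) : BiquadExt a c →* QuadExt c) (ε' / ε) =
        Units.map (algebraMap F (QuadExt c) : F →* QuadExt c) y := by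
      rw [map_div, div_eq_iff_eq_mul]
      exact Units.ext hε'
    exact congrArg Units.val hN
  · intro h
    obtain ⟨η, hη⟩ := exists_norm_eq_of_mem_sup h
    refine tripleVanishes_of_norm_eq (hφ.add_kummerFun hF y) hpres (η * ε) ?_
    rw [Units.val_mul, _root_.map_mul, hη]
    rfl

theorem exists_isLift_presents_norm (hF : ringChar F ≠ 2) {a b c : Fˣ} {ε : (BiquadExt a c)ˣ}
    (hε : NormEqModSquares ε b) :
    ∃ φ, IsLift b c φ ∧ Presents hF b c φ
      (Units.map (Algebra.norm (QuadExt c) : BiquadExt a c →* QuadExt c) ε) := by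
  refine exists_isLift_presents hF _ ?_
  obtain ⟨z, hz⟩ := hε
  refine ⟨z, ?_⟩
  rw [← hz]
  exact Units.ext (Algebra.norm_norm (S := QuadExt c))

/-- A multiple of the character of an element of a subgroup is the character of an element of
that subgroup. -/
theorem exists_kummerFun_eq_mul (hF : ringChar F ≠ 2) {b : Fˣ} {N : Subgroup Fˣ} (hb : b ∈ N)
    (l : ZMod 2) : ∃ b' ∈ N, ∀ g : AbsGal F, kummerFun b' g = l * kummerFun b g := by
  rcases zmod_two_cases l with rfl | rfl
  · refine ⟨1, one_mem _, fun g => ?_⟩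
    rw [zero_mul]
    exact (eq_kummerFun hF one_ne_zero (by simp) (by simp)).symm
  · exact ⟨b, hb, fun g => by rw [one_mul]⟩

/-- The cohomological meaning of a solution `(ε, ν, e, ω)`: cochains `φ`, `φ'` through which
`⟨a, b, c⟩` and `⟨d, c, b⟩` vanish, whose difference is the character of `e` up to norms. -/
theorem exists_cochains_of_scalarEquations (hF : ringChar F ≠ 2) {a b c d : Fˣ}
    (hb : b ∈ normGroup a) (hc : c ∈ normGroup d)
    {ε : (BiquadExt a c)ˣ} {ν : (BiquadExt d b)ˣ} {e : Fˣ} {ω : (BiquadExt b c)ˣ}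
    (hε : NormEqModSquares ε b) (hν : NormEqModSquares ν c) (h : ScalarEquations ε ν e ω) :
    ∃ φ φ' : AbsGal F → ZMod 2, IsLift b c φ ∧ IsLift c b φ' ∧
      (∀ y, TripleVanishes a b c (fun g => φ g + kummerFun y g) ↔
        y ∈ normGroup a ⊔ normGroup (a * c)) ∧
      (∀ y, TripleVanishes d c b (fun g => φ' g + kummerFun y g) ↔
        y ∈ normGroup d ⊔ normGroup (d * b)) ∧
      ∃ b' ∈ normGroup a, ∃ c' ∈ normGroup d, ∀ g,
        φ g = φ' g⁻¹ + (kummerFun e g + kummerFun b' g + kummerFun c' g) := by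
  obtain ⟨φ, hφ, hγ⟩ := exists_isLift_presents_norm hF hε
  obtain ⟨φ', hφ', hβ⟩ := exists_isLift_presents_norm hF hν
  obtain ⟨l, k, hlk⟩ := exists_eq_of_scalarEquations hφ' hγ hβ h.1 h.2
  obtain ⟨b', hb', hbl⟩ := exists_kummerFun_eq_mul hF hb l
  obtain ⟨c', hc', hck⟩ := exists_kummerFun_eq_mul hF hc k
  exact ⟨φ, φ', hφ, hφ', tripleVanishes_add_kummerFun_iff hφ hγ,
    tripleVanishes_add_kummerFun_iff hφ' hβ, b', hb', c', hc', fun g => by rw [hlk, hbl, hck]⟩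

theorem NormEqModSquares.mul_left {u v w y : Fˣ} {ζ ε : (BiquadExt u v)ˣ}
    (hζ : Algebra.norm (QuadExt v) (ζ : BiquadExt u v) = algebraMap F (QuadExt v) y)
    (hε : NormEqModSquares ε w) : NormEqModSquares (ζ * ε) w := by
  obtain ⟨z, hz⟩ := hε
  refine ⟨y * z, ?_⟩
  have : Units.map (Algebra.norm F : BiquadExt u v →* F) ζ = y ^ 2 := by
    refine Units.ext ?_
    rw [Units.coe_map, ← Algebra.norm_norm (S := QuadExt v), hζ, quadExt_norm_eq]
    simp
  rw [_root_.map_mul, hz, this, mul_pow]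
  exact mul_left_comm _ _ _

theorem mem_of_forall_kummerFun_eq (hF : ringChar F ≠ 2) {H : Subgroup Fˣ} {a x y : Fˣ}
    (ha : normGroup a ≤ H) (hy : y ∈ H)
    (h : ∀ g : AbsGal F, kummerFun x g = kummerFun y g) : x ∈ H := by
  obtain ⟨z, rfl⟩ := eqModSquares_of_kummerFun_eq hF (funext h)
  exact mul_mem hy (ha (sq_mem_normGroup a z))

/-- Existence of `e` and `ω` for a given pair `(ε, ν)`. -/
theorem exists_scalar (hF : ringChar F ≠ 2) {a b c d : Fˣ}
    {ε : (BiquadExt a c)ˣ} {ν : (BiquadExt d b)ˣ}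
    (hε : NormEqModSquares ε b) (hν : NormEqModSquares ν c) :
    ∃ (e : Fˣ) (ω : (BiquadExt b c)ˣ), ScalarEquations ε ν e ω := by
  obtain ⟨φ, hφ, hγ⟩ := exists_isLift_presents_norm hF hε
  obtain ⟨φ', hφ', hβ⟩ := exists_isLift_presents_norm hF hν
  obtain ⟨e, he⟩ := hφ.exists_eq_add hF (hφ'.inv hF)
  exact ⟨e, exists_scalarEquations hφ' hγ hβ he⟩

end FourfoldMassey

end

open FourfoldMassey

theorem proposition3p6 {F : Type u} [Field F] (hF : ringChar F ≠ 2) (a b c d : Fˣ)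
    (hab : FourfoldMassey.symbol hF a b = FourfoldMassey.brauerZero F)
    (hbc : FourfoldMassey.symbol hF b c = FourfoldMassey.brauerZero F)
    (hcd : FourfoldMassey.symbol hF c d = FourfoldMassey.brauerZero F) :
    (∀ (ε : (FourfoldMassey.BiquadExt a c)ˣ) (ν : (FourfoldMassey.BiquadExt d b)ˣ),
      FourfoldMassey.NormEqModSquares ε b → FourfoldMassey.NormEqModSquares ν c →
      ∃ (e : Fˣ) (ω : (FourfoldMassey.BiquadExt b c)ˣ),
        FourfoldMassey.ScalarEquations ε ν e ω) ∧
    (∃ e₀ : Fˣ,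
      {e : Fˣ | ∃ (ε : (FourfoldMassey.BiquadExt a c)ˣ) (ν : (FourfoldMassey.BiquadExt d b)ˣ)
          (ω : (FourfoldMassey.BiquadExt b c)ˣ),
          FourfoldMassey.NormEqModSquares ε b ∧ FourfoldMassey.NormEqModSquares ν c ∧
          FourfoldMassey.ScalarEquations ε ν e ω} =
        e₀ • ((FourfoldMassey.normGroup a ⊔ FourfoldMassey.normGroup (a * c) ⊔
          FourfoldMassey.normGroup d ⊔ FourfoldMassey.normGroup (b * d) : Subgroup Fˣ) :
            Set Fˣ)) ∧
    (∀ (ε : (FourfoldMassey.BiquadExt a c)ˣ) (ν : (FourfoldMassey.BiquadExt d b)ˣ)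
      (e : Fˣ) (ω : (FourfoldMassey.BiquadExt b c)ˣ),
      FourfoldMassey.NormEqModSquares ε b → FourfoldMassey.NormEqModSquares ν c →
      FourfoldMassey.ScalarEquations ε ν e ω →
      (FourfoldMassey.MasseyDefined
          ![FourfoldMassey.kummerChar a, FourfoldMassey.kummerChar b,
            FourfoldMassey.kummerChar c, FourfoldMassey.kummerChar d] ↔
        e ∈ FourfoldMassey.normGroup a ⊔ FourfoldMassey.normGroup (a * c) ⊔
          FourfoldMassey.normGroup d ⊔ FourfoldMassey.normGroup (b * d))) := by
  have hb := mem_normGroup_of_symbol_eq hF hab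
  have hcb := mem_normGroup_of_symbol_eq hF hbc
  have hbc' := mem_normGroup_comm hF hcb
  have hc := mem_normGroup_comm hF (mem_normGroup_of_symbol_eq hF hcd)
  obtain ⟨ε₁, hε₁⟩ := exists_normEqModSquares hF hb hbc'
  obtain ⟨ν₁, hν₁⟩ := exists_normEqModSquares hF hc hcb
  obtain ⟨e₁, ω₁, h₁⟩ := exists_scalar hF hε₁ hν₁
  rw [sup_assoc _ (normGroup d), mul_comm b d]
  set S := normGroup a ⊔ normGroup (a * c)
  set T := normGroup d ⊔ normGroup (d * b)
  have haS : normGroup a ≤ S := le_sup_left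
  have hdT : normGroup d ≤ T := le_sup_left
  have hS : S ≤ S ⊔ T := le_sup_left
  have hT : T ≤ S ⊔ T := le_sup_right
  refine ⟨fun ε ν hε hν => exists_scalar hF hε hν, ⟨e₁, Set.ext fun e => ?_⟩,
    fun ε ν e ω hε hν h => ?_⟩
  · rw [Set.mem_smul_set_iff_inv_smul_mem, smul_eq_mul, SetLike.mem_coe]
    constructor
    · rintro ⟨ε, ν, ω, hε, hν, h⟩
      obtain ⟨φ, φ', hφ, hφ', hV, hV', b', hb', c', hc', hrel⟩ :=
        exists_cochains_of_scalarEquations hF hb hc hε hν h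
      obtain ⟨φ₁, φ₁', hφ₁, hφ₁', hV₁, hV₁', b₁, hb₁, c₁, hc₁, hrel₁⟩ :=
        exists_cochains_of_scalarEquations hF hb hc hε₁ hν₁ h₁
      obtain ⟨y, hy⟩ := hφ.exists_eq_add hF hφ₁
      obtain ⟨y', hy'⟩ := hφ'.exists_eq_add hF hφ₁'
      have hone : ∀ g : AbsGal F, kummerFun (1 : Fˣ) g = 0 := fun g =>
        (eq_kummerFun hF one_ne_zero (by simp) (by simp)).symm
      have hyS : y ∈ S := by
        rw [← hV₁, ← funext hy]
        simpa only [hone, add_zero] using (hV 1).mpr (one_mem _)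
      have hyT : y' ∈ T := by
        rw [← hV₁', ← funext hy']
        simpa only [hone, add_zero] using (hV' 1).mpr (one_mem _)
      have hprod : e₁ * e ∈ S ⊔ T := by
        refine mem_of_forall_kummerFun_eq hF (haS.trans hS)
          (y := b₁ * b' * y * (c₁ * c' * y'))
          (Subgroup.mul_mem_sup (mul_mem (mul_mem (haS hb₁) (haS hb')) hyS)
            (mul_mem (mul_mem (hdT hc₁) (hdT hc')) hyT)) fun g => ?_
        have k1 := hrel g
        have k2 := hrel₁ g
        have k3 := hy g
        have k4 := hy' g⁻¹
        rw [kummerFun_inv_apply hF] at k4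
        simp only [kummerFun_unit_mul hF]
        grind
      have : e₁⁻¹ * e = e₁⁻¹ ^ 2 * (e₁ * e) := by
        rw [sq, mul_assoc, inv_mul_cancel_left]
      rw [this]
      exact mul_mem (hS (haS (sq_mem_normGroup a _))) hprod
    · intro h
      obtain ⟨n, hn, n', hn', hnn⟩ := Subgroup.mem_sup.mp h
      obtain ⟨η, hη⟩ := exists_norm_eq_of_mem_sup hn
      obtain ⟨η', hη'⟩ := exists_norm_eq_of_mem_sup hn'
      refine ⟨η * ε₁, η' * ν₁, ω₁, hε₁.mul_left hη, hν₁.mul_left hη', ?_, h₁.2⟩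
      have he : e = n * n' * e₁ := by rw [hnn, mul_right_comm, inv_mul_cancel, one_mul]
      have h' := h₁.1
      rw [he, Units.val_mul, Units.val_mul, _root_.map_mul (Algebra.norm (QuadExt c)),
        _root_.map_mul (Algebra.norm (QuadExt b)), hη, hη',
        _root_.map_mul (inclRight b c), _root_.map_mul (inclLeft b c), AlgHom.commutes,
        AlgHom.commutes, mul_mul_mul_comm, h', Units.val_mul, Units.val_mul, _root_.map_mul,
        _root_.map_mul]
      ring
  · obtain ⟨φ, φ', hφ, hφ', hV, hV', b', hb', c', hc', hrel⟩ :=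
      exists_cochains_of_scalarEquations hF hb hc hε hν h
    rw [masseyDefined_iff hF]
    constructor
    · rintro ⟨φ₀, hφ₀, hT₁, hT₂⟩
      obtain ⟨y, hy⟩ := hφ₀.exists_eq_add hF hφ
      obtain ⟨y', hy'⟩ := (hφ₀.inv hF).exists_eq_add hF hφ'
      rw [funext hy, hV] at hT₁
      rw [funext hy', hV'] at hT₂
      refine mem_of_forall_kummerFun_eq hF (haS.trans hS) (y := b' * y * (c' * y'))
        (Subgroup.mul_mem_sup (mul_mem (haS hb') hT₁) (mul_mem (hdT hc') hT₂)) fun g => ?_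
      have k1 := hrel g
      have k2 := hy g
      have k3 := hy' g⁻¹
      rw [kummerFun_inv_apply hF, inv_inv] at k3
      simp only [kummerFun_unit_mul hF]
      grind
    · intro he
      obtain ⟨n, hn, n', hn', rfl⟩ := Subgroup.mem_sup.mp he
      refine ⟨fun g => φ g + kummerFun (n * b') g, hφ.add_kummerFun hF _,
        (hV _).mpr (mul_mem hn (haS hb')), ?_⟩
      have hrev : (fun g : AbsGal F => φ g⁻¹ + kummerFun (n * b') g⁻¹) =
          fun g => φ' g + kummerFun (n' * c') g := by
        funext g
        rw [hrel, inv_inv]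
        simp only [kummerFun_unit_mul hF, kummerFun_inv_apply hF]
        grind
      rw [hrev, hV']
      exact mul_mem hn' (hdT hc')
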